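/- Let $n\ge 0$ and $T>0$. Let $p\in C^1([0,T],\mathrm{gl}(n,\mathbf C))$ and $q,r\in C([0,T],\mathrm{gl}(n,\mathbf C))$ be such that $p(t)=p(t)^*$, $r(t)=r(t)^*$ and $p(t)$ is invertible for all $t\in[0,T]$, let $R$ be a linear subspace of $\mathbf C^{2n}=\mathbf C^n\times\mathbf C^n$, and let $a\in C^1([0,T],\mathrm{Gl}(n,\mathbf C))$. Consider the index form $$\mathcal I(x,y)=\int_0^T\big((p\dot x+qx,\dot y)+(q^*\dot x,y)+(rx,y)\big)\,dt$$ on the $H^1$ functions $x,y:[0,T]\to\mathbf C^n$ with $(x(0),x(T)),(y(0),y(T))\in R$. Substituting $ax$, $ay$ for $x$, $y$ in it gives the index form with coefficients $$p'=a^*pa,\qquad q'=a^*p\dot a+a^*qa,\qquad r'=\dot a^*p\dot a+\dot a^*qa+a^*q^*\dot a+a^*ra$$ and boundary subspace $R'=\{(x,y)\in\mathbf C^{2n}:(a(0)x,a(T)y)\in R\}$. Let $J=\begin{pmatrix}0&-I_n\\ I_n&0\end{pmatrix}$, let $\gamma$ be the fundamental solution on $[0,T]$ (with $\gamma(0)=I_{2n}$)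 of $\dot u=Jb(t)u$, where $$b=\begin{pmatrix}p^{-1}&-p^{-1}q\\-q^*p^{-1}&q^*p^{-1}q-r\end{pmatrix},$$ and let $\gamma'$ be the fundamental solution obtained in the same way from $p',q',r'$. Put $$W(R)=\{(x,y,z,u)\in\mathbf C^{4n}:(x,-z)\in R^\perp,\ (y,u)\in R\}.$$ For a Lagrangian subspace $W$ of $\mathbf C^{4n}=\mathbf C^{2n}\oplus\mathbf C^{2n}$ with the symplectic form $(-\omega)\oplus\omega$, $\omega(x,y)=(Jx,y)$, and a continuous path $\gamma$ of symplectic matrices on $[0,T]$, the Maslov-type index $i_W(\gamma)$ is defined as follows. Let $\mathcal J=\mathrm{diag}(-J,J)$, write the graph of $\gamma(t)$ and the subspace $W$ as the graphs of unitary maps $U(t)$ and $U'$ from $\ker(\mathcal J-\sqrt{-1}\,I)$ onto $\ker(\mathcal J+\sqrt{-1}\,I)$, and let $i_W(\gamma)$ be minus the spectral flow through $1$ of the unitary path $U'^{-1}U(t)$, $0\le t\le T$. This spectral flow is the number of eigenvalues, with multiplicity, that cross the real axis near $1$ from the open lower half plane to the closed upper half plane, minus the number of those that cross the other way. Then $i_{W(R)}(\gamma)$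 and $i_{W(R')}(\gamma')$ are well-defined integers, and $$i_{W(R')}(\gamma')-i_{W(R)}(\gamma)=\dim_{\mathbf C}(\mathrm{Gr}(I)\cap R')-\dim_{\mathbf C}(\mathrm{Gr}(I)\cap R),$$ where $\mathrm{Gr}(I)=\{(x,x):x\in\mathbf C^n\}$. -/

import Mathlib

open scoped Matrix

namespace MorseIndex

/-! ### Spectral flow through `1` of a path of unitary operators -/

section SpectralFlow

variable {E : Type*} [AddCommGroup E] [Module ℂ E] [Module.Finite ℂ E]

open Classical in
/-- The number of eigenvalues of `A`, counted with algebraic multiplicity, in the half-open arc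
`{exp (iθ) : 0 ≤ θ < ε}` of the unit circle. The arc contains its lower end `1`. -/
noncomputable def arcCount (A : Module.End ℂ E) (ε : ℝ) : ℕ :=
  A.charpoly.roots.countP (fun z => ∃ θ : ℝ, 0 ≤ θ ∧ θ < ε ∧ z = Complex.exp (θ * Complex.I))

/-- `m` is the spectral flow through `1` of the continuous path `A t`, `a ≤ t ≤ b`, of unitary
operators: the number of eigenvalues that cross the real axis near `1` from the open lower half
plane to the closed upper half plane, minus the number of those that cross the other way.
The interval is cut into pieces `[τ k, τ (k + 1)]`, on each of which some `exp (i ε k)` with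
`0 < ε k < π` is never an eigenvalue. On such a piece eigenvalues enter or leave the arc
`{exp (iθ) : 0 ≤ θ < ε k}` only through `1`, so the net number of crossings is the increase of the
number of eigenvalues in this arc. -/
def IsSpectralFlow (a b : ℝ) (A : ℝ → Module.End ℂ E) (m : ℤ) : Prop :=
  ∃ (N : ℕ) (τ ε : ℕ → ℝ),
    τ 0 = a ∧ τ N = b ∧
    (∀ k < N, τ k ≤ τ (k + 1)) ∧
    (∀ k < N, 0 < ε k ∧ ε k < Real.pi) ∧
    (∀ k < N, ∀ t ∈ Set.Icc (τ k) (τ (k + 1)),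
      ¬ (A t).HasEigenvalue (Complex.exp (ε k * Complex.I))) ∧
    m = ∑ k ∈ Finset.range N,
      ((arcCount (A (τ (k + 1))) (ε k) : ℤ) - (arcCount (A (τ k)) (ε k) : ℤ))

end SpectralFlow

/-! ### The Maslov index of a path of pairs of Lagrangian subspaces

`E` is a complex inner product space with an operator `j`, `j * j = -1`, skew-adjoint, and carries
the symplectic form `ω(x, y) = (j x, y)`. -/

section Maslov

variable {E : Type*} [NormedAddCommGroup E] [InnerProductSpace ℂ E]

/-- The space of unitary maps from `ker (j - i)` onto `ker (j + i)`. -/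
abbrev UnitaryMaps (j : Module.End ℂ E) : Type _ :=
  Module.End.eigenspace j Complex.I ≃ₗᵢ[ℂ] Module.End.eigenspace j (-Complex.I)

/-- `Λ` is the graph `{x + U x}` of the unitary map `U : ker (j - i) → ker (j + i)`. The Lagrangian
subspaces are exactly the graphs of such maps. -/
def IsGraphOf (j : Module.End ℂ E) (Λ : Submodule ℂ E) (U : UnitaryMaps j) : Prop :=
  ∀ z : E, z ∈ Λ ↔ ∃ x : Module.End.eigenspace j Complex.I, z = (x : E) + (U x : E)

/-- `m` is the Maslov index of the path `(Λ t, Λ' t)`, `a ≤ t ≤ b`, of pairs of Lagrangian subspaces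
with `Λ t = Gr (U t)` and `Λ' t = Gr (U' t)`: minus the spectral flow through `1` of
`(U' t)⁻¹ ∘ U t`. -/
def IsMaslovIndex [FiniteDimensional ℂ E] (j : Module.End ℂ E) (a b : ℝ)
    (Λ Λ' : ℝ → Submodule ℂ E) (m : ℤ) : Prop :=
  ∃ U U' : ℝ → UnitaryMaps j,
    (∀ t ∈ Set.Icc a b, IsGraphOf j (Λ t) (U t) ∧ IsGraphOf j (Λ' t) (U' t)) ∧
    IsSpectralFlow a b
      (fun t => (((U t).trans (U' t).symm).toLinearEquiv :
        Module.End ℂ (Module.End.eigenspace j Complex.I))) (-m)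

end Maslov

/-! ### Pairs of vectors, graphs and the Maslov-type index of a symplectic path -/

section MaslovType

variable {ι : Type*} [Fintype ι] [DecidableEq ι]

/-- The pair `(x, y)` as a vector of the Hermitian space `ℂ^ι ⊕ ℂ^ι`. -/
noncomputable def pair (x y : ι → ℂ) : EuclideanSpace ℂ (ι ⊕ ι) := WithLp.toLp 2 (Sum.elim x y)

/-- First component of a pair. -/
def fstC (z : EuclideanSpace ℂ (ι ⊕ ι)) : ι → ℂ := fun i => z (Sum.inl i)

/-- Second component of a pair. -/
def sndC (z : EuclideanSpace ℂ (ι ⊕ ι)) : ι → ℂ := fun i => z (Sum.inr i)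

/-- The graph `{(x, M x)}` of a matrix. -/
def graph (M : Matrix ι ι ℂ) : Submodule ℂ (EuclideanSpace ℂ (ι ⊕ ι)) where
  carrier := {z | sndC z = M *ᵥ fstC z}
  zero_mem' := by
    change (0 : ι → ℂ) = M *ᵥ (0 : ι → ℂ)
    simp
  add_mem' := by
    intro x y hx hy
    change sndC x + sndC y = M *ᵥ (fstC x + fstC y)
    rw [Matrix.mulVec_add]
    exact congrArg₂ (· + ·) hx hy
  smul_mem' := by
    intro c x hx
    change c • sndC x = M *ᵥ (c • fstC x)
    rw [Matrix.mulVec_smul]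
    exact congrArg (c • ·) hx

/-- The operator `diag (-J, J)` on `ℂ^{2n} ⊕ ℂ^{2n}`, where `J = (0, -I; I, 0)`. It defines the
symplectic form `(-ω) ⊕ ω`, where `ω(x, y) = (J x, y)`. -/
noncomputable def doubleJ (ι : Type*) [Fintype ι] [DecidableEq ι] :
    Module.End ℂ (EuclideanSpace ℂ ((ι ⊕ ι) ⊕ (ι ⊕ ι))) :=
  Matrix.toEuclideanLin (Matrix.fromBlocks (-(Matrix.J ι ℂ)) 0 0 (Matrix.J ι ℂ))

/-- `m` is the Maslov-type index `i_W(γ)` of the path `γ t`, `0 ≤ t ≤ T`, of symplectic matrices: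
the Maslov index of `(Gr (γ t), W)` with respect to the symplectic form `(-ω) ⊕ ω`. -/
def IsMaslovTypeIndex (T : ℝ) (W : Submodule ℂ (EuclideanSpace ℂ ((ι ⊕ ι) ⊕ (ι ⊕ ι))))
    (γ : ℝ → Matrix (ι ⊕ ι) (ι ⊕ ι) ℂ) (m : ℤ) : Prop :=
  IsMaslovIndex (doubleJ ι) 0 T (fun t => graph (γ t)) (fun _ => W) m

/-- `W(R) = {(x, y, z, u) : (x, -z) ∈ R^⊥, (y, u) ∈ R}`. -/
noncomputable def boundaryW (R : Submodule ℂ (EuclideanSpace ℂ (ι ⊕ ι))) :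
    Submodule ℂ (EuclideanSpace ℂ ((ι ⊕ ι) ⊕ (ι ⊕ ι))) where
  carrier := {w |
    pair (fun i => w (Sum.inl (Sum.inl i))) (fun i => -w (Sum.inr (Sum.inl i))) ∈ Rᗮ ∧
    pair (fun i => w (Sum.inl (Sum.inr i))) (fun i => w (Sum.inr (Sum.inr i))) ∈ R}
  zero_mem' := by
    constructor
    · convert Rᗮ.zero_mem using 1
      ext (i | i) <;> simp [pair]
    · convert R.zero_mem using 1
      ext (i | i) <;> simp [pair]
  add_mem' := by
    rintro x y ⟨h1, h2⟩ ⟨h3, h4⟩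
    constructor
    · convert Rᗮ.add_mem h1 h3 using 1
      ext (i | i) <;> simp [pair, add_comm]
    · convert R.add_mem h2 h4 using 1
      ext (i | i) <;> simp [pair]
  smul_mem' := by
    rintro c x ⟨h1, h2⟩
    constructor
    · convert Rᗮ.smul_mem c h1 using 1
      ext (i | i) <;> simp [pair]
    · convert R.smul_mem c h2 using 1
      ext (i | i) <;> simp [pair]

end MaslovType

/-! ### The Hamiltonian system of an index form, and the change of frame -/

section Frame

variable {ι : Type*} [Fintype ι] [DecidableEq ι]

/-- `a` is continuously differentiable on `[0, T]` (one-sided derivatives at the ends). -/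
def IsC1On (T : ℝ) (a : ℝ → Matrix ι ι ℂ) : Prop :=
  ∀ i k, ContDiffOn ℝ 1 (fun t => a t i k) (Set.Icc 0 T)

/-- The derivative of `a` on `[0, T]` (one-sided at the ends). -/
noncomputable def dotC (T : ℝ) (a : ℝ → Matrix ι ι ℂ) (t : ℝ) : Matrix ι ι ℂ :=
  Matrix.of fun i k => derivWithin (fun s => a s i k) (Set.Icc 0 T) t

/-- The matrix `b = (p⁻¹, -p⁻¹q; -q*p⁻¹, q*p⁻¹q - r)`. -/
noncomputable def hamiltonian (p q r : Matrix ι ι ℂ) : Matrix (ι ⊕ ι) (ι ⊕ ι) ℂ :=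
  Matrix.fromBlocks p⁻¹ (-(p⁻¹ * q)) (-(qᴴ * p⁻¹)) (qᴴ * p⁻¹ * q - r)

/-- `γ` is the fundamental solution on `[0, T]` of the Hamiltonian equation `u' = J b(t) u`:
the matrix solution with `γ 0 = 1`. -/
def IsFundamentalSolution (T : ℝ) (b γ : ℝ → Matrix (ι ⊕ ι) (ι ⊕ ι) ℂ) : Prop :=
  γ 0 = 1 ∧ ∀ t ∈ Set.Icc 0 T, ∀ i k,
    HasDerivWithinAt (fun s => γ s i k) ((Matrix.J ι ℂ * b t * γ t) i k) (Set.Icc 0 T) t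

/-- The integrand `(p v + q x, w) + (q* v, y) + (r x, y)` of the index form, at `x, y` with
derivatives `v, w`. Here `(x, y) = y* x`. -/
noncomputable def indexIntegrand (p q r : Matrix ι ι ℂ) (x v y w : ι → ℂ) : ℂ :=
  (p *ᵥ v + q *ᵥ x) ⬝ᵥ star w + (qᴴ *ᵥ v) ⬝ᵥ star y + (r *ᵥ x) ⬝ᵥ star y

/-- The coefficient `p'` of the index form in the new frame `x ↦ a x`. -/
def frameP (p a : Matrix ι ι ℂ) : Matrix ι ι ℂ := aᴴ * p * a

/-- The coefficient `q'` of the index form in the new frame; `d` is the derivative of `a`. -/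
def frameQ (p q a d : Matrix ι ι ℂ) : Matrix ι ι ℂ := aᴴ * p * d + aᴴ * q * a

/-- The coefficient `r'` of the index form in the new frame; `d` is the derivative of `a`. -/
def frameR (p q r a d : Matrix ι ι ℂ) : Matrix ι ι ℂ :=
  dᴴ * p * d + dᴴ * q * a + aᴴ * qᴴ * d + aᴴ * r * a

set_option linter.unusedSectionVars false in
/-- The new coefficients are those obtained by substituting `a x`, with derivative `a v + d x`,
for `x` in the index form. -/
theorem indexIntegrand_frame (p q r a d : Matrix ι ι ℂ) (hp : pᴴ = p) (x v y w : ι → ℂ) :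
    indexIntegrand (frameP p a) (frameQ p q a d) (frameR p q r a d) x v y w =
      indexIntegrand p q r (a *ᵥ x) (a *ᵥ v + d *ᵥ x) (a *ᵥ y) (a *ᵥ w + d *ᵥ y) := by
  have key : ∀ (A : Matrix ι ι ℂ) (f g : ι → ℂ), f ⬝ᵥ star (A *ᵥ g) = (Aᴴ *ᵥ f) ⬝ᵥ star g := by
    intro A f g
    rw [Matrix.star_mulVec, dotProduct_comm f, ← Matrix.dotProduct_mulVec, dotProduct_comm]
  simp only [indexIntegrand, frameP, frameQ, frameR, star_add, dotProduct_add, key,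
    Matrix.mulVec_add, Matrix.add_mulVec, add_dotProduct, Matrix.mulVec_mulVec,
    Matrix.conjTranspose_add, Matrix.conjTranspose_mul, Matrix.conjTranspose_conjTranspose, hp,
    Matrix.mul_assoc]
  ring

/-- `R' = {(x, y) : (α x, β y) ∈ R}`, with `α = a(0)` and `β = a(T)`. -/
noncomputable def frameBoundary (α β : Matrix ι ι ℂ)
    (R : Submodule ℂ (EuclideanSpace ℂ (ι ⊕ ι))) :
    Submodule ℂ (EuclideanSpace ℂ (ι ⊕ ι)) :=
  R.comap (Matrix.toEuclideanLin (Matrix.fromBlocks α 0 0 β))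

end Frame

end MorseIndex

/-! The change of frame is deformed to the identity, and the change of the index is read off from
the boundary of the homotopy.

Constancy of a Wronskian gives `γ' t = L(t) γ(t) L(0)⁻¹`, where `L(t) = diag(a(t)^*, a(t)⁻¹)` is
symplectic (`IsFundamentalSolution.eq_liftFrame`). Since `GL(n, ℂ)` is connected and `[0, T]` is
contractible, `a` is joined to `1` by invertible functions `A(s, t)`. The same formulas with `A(s,
·)` in place of `a` give symplectic paths `G(s, t)` and boundary spaces `R_s`, hence a two-parameter
family of unitary matrices `V'^* V` whose spectrum `S(s, t)` varies continuously on the circle.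

Let `φ` be a continuous argument of the product of the points of `S`, and let `F` be `φ` minus the
sum of their arguments in `[0, 2π)`. The function `F` jumps only when points pass through `1`, and
the spectral flow of any path in the parameter plane is the increase of `F / 2π`
(`IsMultisetFlow.eq`). So `2π (i' - i)` is the change of `F` along the side `t = 0` minus its change
along the side `t = T`.

On `t = T` the map `diag(L(0), L(T))` taken at `s` carries the pair `(Gr γ(T), W(R))` to the pair at
`s`. The multiplicity of `1` is therefore constant, and so is `F`. On `t = 0` the pair is `(Gr(I),
W(R_s))`; both spaces are invariant under the flip `(x, y, z, u) ↦ (x, -y, z, -u)`, so the spectrum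
is symmetric under conjugation and `F` changes by `π` times the change of the multiplicity of `1`.
Hence `2 (i' - i)` is the change of `dim (Gr(I) ∩ W(R_s))` (`maslovIndex_homotopy`).

Finally `Gr(I_{2n}) = W(Gr(I_n))`, and `dim (W(R) ∩ W(S)) = 2 dim (R ∩ S) + 2n - dim R - dim S`
(`finrank_boundaryW_inf`). As `dim R' = dim R`, the factor `2` cancels and the theorem follows. -/

namespace MorseIndex
open Filter Topology

/-! ### Continuous families of finite multisets on the unit circle -/

/-- A family of multisets of `N` points of the unit circle that depends continuously on a
parameter: the monic polynomials with these roots depend continuously on it. -/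
structure IsCircleFamily {X : Type*} [TopologicalSpace X] (N : ℕ) (S : X → Multiset ℂ) : Prop where
  card_eq : ∀ x, (S x).card = N
  norm_eq : ∀ x, ∀ z ∈ S x, ‖z‖ = 1
  continuous_prod : ∀ w : ℂ, Continuous fun x => ((S x).map (fun z => w - z)).prod

section Family

variable {X : Type*} [TopologicalSpace X] {N : ℕ} {S : X → Multiset ℂ}

theorem exists_fin_map_eq {M : Multiset ℂ} (h : M.card = N) :
    ∃ l : Fin N → ℂ, M = (Finset.univ : Finset (Fin N)).val.map l := by
  subst h
  induction M using Quotient.inductionOn with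
  | _ L =>
    refine ⟨fun i => L.get i, ?_⟩
    rw [Fin.univ_val_map]
    simp

theorem eq_of_forall_prod_sub_eq {M M' : Multiset ℂ}
    (h : ∀ w : ℂ, (M.map (fun z => w - z)).prod = (M'.map (fun z => w - z)).prod) : M = M' := by
  have : (M.map (fun z => Polynomial.X - Polynomial.C z)).prod =
      (M'.map (fun z => Polynomial.X - Polynomial.C z)).prod := by
    refine Polynomial.funext fun w => ?_
    simpa [Polynomial.eval_multiset_prod, Multiset.map_map] using h w
  rw [← Polynomial.roots_multiset_prod_X_sub_C M, this, Polynomial.roots_multiset_prod_X_sub_C]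

theorem IsCircleFamily.comp {Y : Type*} [TopologicalSpace Y] (hS : IsCircleFamily N S) {f : Y → X}
    (hf : Continuous f) : IsCircleFamily N (fun y => S (f y)) :=
  ⟨fun _ => hS.card_eq _, fun _ => hS.norm_eq _, fun w => (hS.continuous_prod w).comp hf⟩

/-- A continuous labelling of the points need not exist over `X`. Along an ultrafilter any labelling
converges, by compactness of the torus, and the limit is identified with `S x₀` by comparing the
monic polynomials. -/
theorem IsCircleFamily.exists_tendsto (hS : IsCircleFamily N S) (x₀ : X) (F : Ultrafilter X)
    (hF : (F : Filter X) ≤ 𝓝 x₀) :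
    ∃ (l : X → Fin N → ℂ) (l₀ : Fin N → ℂ),
      (∀ x, S x = (Finset.univ : Finset (Fin N)).val.map (l x)) ∧
      S x₀ = (Finset.univ : Finset (Fin N)).val.map l₀ ∧ ∀ i, Tendsto (fun x => l x i) F (𝓝 (l₀ i)) := by
  choose l hl using fun x => exists_fin_map_eq (hS.card_eq x)
  have hK : IsCompact (Set.univ.pi fun _ : Fin N => Metric.sphere (0 : ℂ) 1) :=
    isCompact_univ_pi fun _ => isCompact_sphere 0 1
  obtain ⟨l₀, -, hl₀⟩ := hK.ultrafilter_le_nhds (F.map l) (by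
    refine le_principal_iff.2 (Filter.mem_map.2 (Filter.univ_mem' fun x => ?_))
    intro i _
    have : l x i ∈ S x := by rw [hl x]; exact Multiset.mem_map_of_mem _ (Finset.mem_univ i)
    simpa using hS.norm_eq x _ this)
  have hl₀' : Tendsto l F (𝓝 l₀) := hl₀
  have hlim := tendsto_pi_nhds.1 hl₀'
  refine ⟨l, l₀, hl, eq_of_forall_prod_sub_eq fun w => ?_, hlim⟩
  have h1 : Tendsto (fun x => ((S x).map (fun z => w - z)).prod) F
      (𝓝 ((S x₀).map (fun z => w - z)).prod) := ((hS.continuous_prod w).tendsto x₀).mono_left hF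
  have h2 : Tendsto (fun x => ∏ i, (w - l x i)) F (𝓝 (∏ i, (w - l₀ i))) :=
    tendsto_finsetProd _ fun i _ => (hlim i).const_sub w
  have h3 : (fun x => ((S x).map (fun z => w - z)).prod) = fun x => ∏ i, (w - l x i) := by
    funext x
    rw [hl x, Multiset.map_map]; rfl
  rw [h3] at h1
  rw [tendsto_nhds_unique h1 h2, Multiset.map_map]; rfl

theorem IsCircleFamily.isOpen_notMem (hS : IsCircleFamily N S) (w : ℂ) :
    IsOpen {x | w ∉ S x} := by
  have : {x | w ∉ S x} = (fun x => ((S x).map (fun z => w - z)).prod) ⁻¹' {0}ᶜ := by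
    ext x
    simp [Multiset.prod_eq_zero_iff, sub_eq_zero]
  rw [this]
  exact isOpen_compl_singleton.preimage (hS.continuous_prod w)

/-- The argument in `[0, 2π)`. -/
noncomputable def angle (z : ℂ) : ℝ := Real.pi - (-(starRingEnd ℂ z)).arg

/-- The map `z ↦ -conj z` moves the cut of the principal argument to the positive axis, and `π -
arg` turns `(-π, π]` into `[0, 2π)`; the value at `1` is thus `0`, matching the closed lower end of
the arcs. -/
theorem angle_exp {θ : ℝ} (h0 : 0 ≤ θ) (h1 : θ < 2 * Real.pi) :
    angle (Complex.exp (θ * Complex.I)) = θ := by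
  have : -(starRingEnd ℂ (Complex.exp (θ * Complex.I))) =
      Complex.exp ((Real.pi - θ : ℝ) * Complex.I) := by
    rw [← Complex.exp_conj]
    simp [sub_mul, Complex.exp_sub, Complex.exp_neg, Complex.exp_pi_mul_I, neg_div]
  rw [angle, this, Complex.arg_exp_mul_I, (toIocMod_eq_self _).2 ⟨by linarith, by linarith⟩]
  ring

theorem exp_angle {z : ℂ} (hz : ‖z‖ = 1) : Complex.exp (angle z * Complex.I) = z := by
  have h := Complex.norm_mul_exp_arg_mul_I (-(starRingEnd ℂ z))
  have h1 : ‖-(starRingEnd ℂ z)‖ = 1 := by simpa using hz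
  rw [h1, Complex.ofReal_one, one_mul] at h
  have h2 : z ≠ 0 := by rintro rfl; simp at hz
  rw [angle, Complex.ofReal_sub, sub_mul, Complex.exp_sub, Complex.exp_pi_mul_I, h, neg_div_neg_eq,
    ← Complex.inv_eq_conj hz, one_div, inv_inv]

theorem angle_nonneg (z : ℂ) : 0 ≤ angle z := by
  have := Complex.arg_le_pi (-(starRingEnd ℂ z))
  rw [angle]; linarith

theorem angle_lt (z : ℂ) : angle z < 2 * Real.pi := by
  have := Complex.neg_pi_lt_arg (-(starRingEnd ℂ z))
  rw [angle]; linarith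

theorem angle_eq_of_exp {z : ℂ} {θ : ℝ} (h0 : 0 ≤ θ) (h1 : θ < 2 * Real.pi)
    (hz : Complex.exp (θ * Complex.I) = z) : angle z = θ := hz ▸ angle_exp h0 h1

theorem angle_one : angle 1 = 0 := angle_eq_of_exp le_rfl Real.two_pi_pos (by simp)

theorem continuousAt_angle {z : ℂ} (hz : ‖z‖ = 1) (h1 : z ≠ 1) : ContinuousAt angle z := by
  have hs : -(starRingEnd ℂ z) ∈ Complex.slitPlane := by
    rw [Complex.mem_slitPlane_iff_arg]
    refine ⟨fun h => h1 ?_, ?_⟩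
    · rw [← exp_angle hz, angle, h]; simp
    · rw [← norm_ne_zero_iff]; simp [hz]
  have h2 : ContinuousAt (fun w : ℂ => -(starRingEnd ℂ w)) z :=
    Complex.continuous_conj.neg.continuousAt
  exact continuousAt_const.sub (ContinuousAt.comp (f := fun w : ℂ => -(starRingEnd ℂ w)) (Complex.continuousAt_arg hs) h2)

/-- The sum of the arguments in `[0, 2π)` of the numbers `c z`, `z ∈ M`. -/
noncomputable def angleSum (c : ℂ) (M : Multiset ℂ) : ℝ := (M.map fun z => angle (c * z)).sum

/-- The angle sum is a possibly discontinuous argument of the rotated product. It therefore differs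
from a continuous argument by a function with values in a fixed coset of `2πℤ`. -/
theorem exp_angleSum {c : ℂ} (hc : ‖c‖ = 1) {M : Multiset ℂ} (hM : ∀ z ∈ M, ‖z‖ = 1) :
    Complex.exp (angleSum c M * Complex.I) = c ^ M.card * M.prod := by
  induction M using Multiset.induction with
  | empty => simp [angleSum]
  | cons a M ih =>
    have h1 := ih fun z hz => hM z (Multiset.mem_cons_of_mem hz)
    have h2 : ‖c * a‖ = 1 := by simp [hc, hM a (Multiset.mem_cons_self _ _)]
    rw [angleSum] at h1 ⊢
    simp only [Multiset.map_cons, Multiset.sum_cons, Complex.ofReal_add, add_mul, Complex.exp_add,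
      h1, exp_angle h2, Multiset.card_cons, Multiset.prod_cons]
    ring

/-- Where the multiplicity of `c⁻¹` is locally constant, the sum of the arguments of the rotated
points is continuous. -/
theorem IsCircleFamily.continuousWithinAt_angleSum (hS : IsCircleFamily N S) {c : ℂ} (hc : ‖c‖ = 1)
    {s : Set X} {x₀ : X} (h : ∀ᶠ x in 𝓝[s] x₀, (S x).count c⁻¹ = (S x₀).count c⁻¹) :
    ContinuousWithinAt (fun x => angleSum c (S x)) s x₀ := by
  rw [ContinuousWithinAt, tendsto_iff_ultrafilter]
  intro F hF
  obtain ⟨l, l₀, hl, hl₀, hlim⟩ := hS.exists_tendsto x₀ F (hF.trans nhdsWithin_le_nhds)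
  have hsum : ∀ x, angleSum c (S x) = ∑ i, angle (c * l x i) := fun x => by
    rw [angleSum, hl x, Multiset.map_map]; rfl
  have hsum₀ : angleSum c (S x₀) = ∑ i, angle (c * l₀ i) := by
    rw [angleSum, hl₀, Multiset.map_map]; rfl
  have hn : ∀ i, ‖l₀ i‖ = 1 := fun i => hS.norm_eq x₀ _ (by
    rw [hl₀]; exact Multiset.mem_map_of_mem _ (Finset.mem_univ i))
  have hcount : ∀ k : Fin N → ℂ, ((Finset.univ : Finset (Fin N)).val.map k).count c⁻¹ =
      (Finset.univ.filter fun i => k i = c⁻¹).card := by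
    intro k
    rw [Multiset.count_map]
    simp only [Finset.card_def, Finset.filter_val, eq_comm]
  -- No new index can reach `c⁻¹` near `x₀`; equality of the multiplicities then shows that no index
  -- leaves it either.
  have hne : ∀ᶠ x in (F : Filter X), ∀ i, l₀ i ≠ c⁻¹ → l x i ≠ c⁻¹ := by
    rw [eventually_all]
    intro i
    by_cases hi : l₀ i = c⁻¹
    · simp [hi]
    · filter_upwards [(hlim i).eventually_ne hi] with x hx _ using hx
  have heq : ∀ᶠ x in (F : Filter X), ∀ i, l₀ i = c⁻¹ → l x i = c⁻¹ := by
    filter_upwards [hne, hF h] with x hx hcx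
    rw [hl x, hl₀, hcount, hcount] at hcx
    have hsub : (Finset.univ.filter fun i => l x i = c⁻¹) ⊆
        Finset.univ.filter fun i => l₀ i = c⁻¹ := by
      intro i hi
      simp only [Finset.mem_filter, Finset.mem_univ, true_and] at hi ⊢
      by_contra h'
      exact hx i h' hi
    have := Finset.eq_of_subset_of_card_le hsub hcx.ge
    intro i hi
    have hmem : i ∈ Finset.univ.filter fun i => l₀ i = c⁻¹ := by simp [hi]
    rw [← this] at hmem
    simpa using hmem
  rw [hsum₀]
  simp only [hsum]
  refine tendsto_finsetSum _ fun i _ => ?_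
  by_cases hi : l₀ i = c⁻¹
  · refine tendsto_const_nhds.congr' ?_
    filter_upwards [heq] with x hx
    rw [hx i hi, hi]
  · have h1 : ContinuousAt angle (c * l₀ i) :=
      continuousAt_angle (by simp [hc, hn]) fun h' => hi (eq_inv_of_mul_eq_one_right h')
    exact h1.tendsto.comp ((hlim i).const_mul c)

/-- The number of points in the half-open arc `{exp (iθ) : 0 ≤ θ < ε}`. -/
noncomputable def arcCard (M : Multiset ℂ) (ε : ℝ) : ℕ := by
  classical
  exact M.countP (fun z => ∃ θ : ℝ, 0 ≤ θ ∧ θ < ε ∧ z = Complex.exp (θ * Complex.I))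

/-- Rotation by `-ε` lowers the angle by `ε`, except that the points of the arc pass the cut at `1`
and gain `2π`. Summation over a multiset turns the arc count into a difference of angle sums. -/
theorem angle_mul_exp_neg {z : ℂ} (hz : ‖z‖ = 1) {ε : ℝ} (h0 : 0 < ε) (h1 : ε < Real.pi)
    [Decidable (∃ θ : ℝ, 0 ≤ θ ∧ θ < ε ∧ z = Complex.exp (θ * Complex.I))] :
    angle (Complex.exp (-(ε * Complex.I)) * z) + ε = angle z + 2 * Real.pi *
      (if ∃ θ : ℝ, 0 ≤ θ ∧ θ < ε ∧ z = Complex.exp (θ * Complex.I) then 1 else 0 : ℝ) := by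
  have hz' := exp_angle hz
  have ha := angle_nonneg z
  have hb := angle_lt z
  split_ifs with h
  · obtain ⟨θ, h2, h3, rfl⟩ := h
    rw [angle_exp h2 (by linarith), angle_eq_of_exp (θ := θ - ε + 2 * Real.pi) (by linarith)
      (by linarith)]
    · ring
    · push_cast
      rw [add_mul, Complex.exp_add, Complex.exp_two_pi_mul_I, sub_mul, sub_eq_neg_add,
        Complex.exp_add, mul_one]
  · have h2 : ε ≤ angle z := by
      by_contra! h'
      exact h ⟨_, ha, h', hz'.symm⟩
    rw [angle_eq_of_exp (θ := angle z - ε) (by linarith) (by linarith)]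
    · ring
    · push_cast
      rw [sub_mul, sub_eq_neg_add, Complex.exp_add, hz']

theorem angleSum_exp_neg {M : Multiset ℂ} (hM : ∀ z ∈ M, ‖z‖ = 1) {ε : ℝ} (h0 : 0 < ε)
    (h1 : ε < Real.pi) :
    angleSum (Complex.exp (-(ε * Complex.I))) M + M.card * ε =
      angleSum 1 M + 2 * Real.pi * arcCard M ε := by
  classical
  induction M using Multiset.induction with
  | empty => simp [angleSum, arcCard]
  | cons a M ih =>
    have h2 := ih fun z hz => hM z (Multiset.mem_cons_of_mem hz)
    have h3 := angle_mul_exp_neg (hM a (Multiset.mem_cons_self _ _)) h0 h1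
    have h4 : (arcCard (a ::ₘ M) ε : ℝ) = arcCard M ε +
        (if ∃ θ : ℝ, 0 ≤ θ ∧ θ < ε ∧ a = Complex.exp (θ * Complex.I) then 1 else 0 : ℝ) := by
      simp only [arcCard, Multiset.countP_cons]
      push_cast
      congr
    rw [h4]
    simp only [angleSum, Multiset.map_cons, Multiset.sum_cons, Multiset.card_cons, one_mul] at h2 ⊢
    push_cast
    linarith

/-- A continuous function on an interval with values in the discrete set `2πℤ` is constant. -/
theorem eq_of_exp_mul_I_eq_one {f : ℝ → ℝ} {a b : ℝ} (hab : a ≤ b)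
    (hf : ContinuousOn f (Set.Icc a b))
    (h : ∀ t ∈ Set.Icc a b, Complex.exp (f t * Complex.I) = 1) : f b = f a := by
  have hk : ∀ t ∈ Set.Icc a b, ∃ k : ℤ, f t = k * (2 * Real.pi) := by
    intro t ht
    obtain ⟨k, hk⟩ := Complex.exp_eq_one_iff.1 (h t ht)
    refine ⟨k, ?_⟩
    have := congrArg Complex.im hk
    simpa using this
  by_contra hne
  have hpi := Real.two_pi_pos
  obtain ⟨k, hk1⟩ := hk a (Set.left_mem_Icc.2 hab)
  obtain ⟨l, hl1⟩ := hk b (Set.right_mem_Icc.2 hab)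
  have hconn := (isPreconnected_Icc (a := a) (b := b)).image f hf
  have hord := hconn.ordConnected
  have ha : f a ∈ f '' Set.Icc a b := ⟨a, Set.left_mem_Icc.2 hab, rfl⟩
  have hb : f b ∈ f '' Set.Icc a b := ⟨b, Set.right_mem_Icc.2 hab, rfl⟩
  -- If the end values differ, they are at least `2π` apart, so the lower one plus `π` is also
  -- attained; it is not in `2πℤ`.
  have hmid : (min (f a) (f b)) + Real.pi ∈ f '' Set.Icc a b := by
    have key : ∀ m n : ℤ, m < n → (m : ℝ) * (2 * Real.pi) + 2 * Real.pi ≤ n * (2 * Real.pi) := by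
      intro m n hmn
      have : (m : ℝ) + 1 ≤ n := by exact_mod_cast hmn
      nlinarith
    have hkl : k ≠ l := by rintro rfl; exact hne (hl1.trans hk1.symm)
    rcases lt_or_gt_of_ne hkl with hlt | hlt
    · have := key _ _ hlt
      rw [min_eq_left (by linarith)]
      exact hord.out ha hb ⟨by linarith, by linarith⟩
    · have := key _ _ hlt
      rw [min_eq_right (by linarith)]
      exact hord.out hb ha ⟨by linarith, by linarith⟩
  obtain ⟨t, ht, htm⟩ := hmid
  obtain ⟨j, hj⟩ := hk t ht
  obtain ⟨i, hi⟩ : ∃ i : ℤ, min (f a) (f b) = i * (2 * Real.pi) := by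
    rcases min_choice (f a) (f b) with h' | h'
    · exact ⟨k, h'.trans hk1⟩
    · exact ⟨l, h'.trans hl1⟩
  rw [hj, hi] at htm
  have h3 : (2 * (j - i) : ℝ) = 1 := by
    have : (2 * (j - i) : ℝ) * Real.pi = 1 * Real.pi := by linarith
    exact mul_right_cancel₀ Real.pi_ne_zero this
  have h4 : (2 * (j - i) : ℤ) = 1 := by exact_mod_cast h3
  omega

end Family

/-! ### The spectral flow of a continuous family of multisets -/

section Flow

variable {N : ℕ} {S : ℝ → Multiset ℂ} {φ : ℝ → ℝ}

/-- The spectral flow through `1` of a path of multisets of points of the unit circle. -/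
def IsMultisetFlow (a b : ℝ) (S : ℝ → Multiset ℂ) (m : ℤ) : Prop :=
  ∃ (N : ℕ) (τ ε : ℕ → ℝ),
    τ 0 = a ∧ τ N = b ∧
    (∀ k < N, τ k ≤ τ (k + 1)) ∧
    (∀ k < N, 0 < ε k ∧ ε k < Real.pi) ∧
    (∀ k < N, ∀ t ∈ Set.Icc (τ k) (τ (k + 1)), Complex.exp (ε k * Complex.I) ∉ S t) ∧
    m = ∑ k ∈ Finset.range N,
      ((arcCard (S (τ (k + 1))) (ε k) : ℤ) - (arcCard (S (τ k)) (ε k) : ℤ))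

/-- As `exp (iε)` is never in `S t`, the angle sum of the points rotated by `-ε` is continuous.
Corrected by `N ε`, it is another argument of the product, so it differs from `φ` by a constant, and
`angleSum_exp_neg` brings in the arc counts. -/
theorem IsCircleFamily.arcCard_sub (hS : IsCircleFamily N S) (hφ : Continuous φ)
    (hφS : ∀ t, Complex.exp (φ t * Complex.I) = (S t).prod) {a b ε : ℝ} (hab : a ≤ b)
    (h0 : 0 < ε) (h1 : ε < Real.pi)
    (hε : ∀ t ∈ Set.Icc a b, Complex.exp (ε * Complex.I) ∉ S t) :
    2 * Real.pi * ((arcCard (S b) ε : ℝ) - arcCard (S a) ε) =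
      (φ b - angleSum 1 (S b)) - (φ a - angleSum 1 (S a)) := by
  have hc : ‖Complex.exp (-(ε * Complex.I))‖ = 1 := by
    rw [← neg_mul, ← Complex.ofReal_neg, Complex.norm_exp_ofReal_mul_I]
  have hcont : ContinuousOn (fun t => angleSum (Complex.exp (-(ε * Complex.I))) (S t))
      (Set.Icc a b) := by
    intro t ht
    refine hS.continuousWithinAt_angleSum hc ?_
    filter_upwards [self_mem_nhdsWithin] with x hx
    rw [← Complex.exp_neg, neg_neg, Multiset.count_eq_zero_of_notMem (hε x hx),
      Multiset.count_eq_zero_of_notMem (hε t ht)]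
  have := eq_of_exp_mul_I_eq_one (f := fun t =>
    angleSum (Complex.exp (-(ε * Complex.I))) (S t) + N * ε - φ t) hab
    ((hcont.add continuousOn_const).sub hφ.continuousOn) (by
      intro t ht
      push_cast
      rw [sub_mul, Complex.exp_sub, hφS, add_mul, Complex.exp_add,
        exp_angleSum hc (hS.norm_eq t), hS.card_eq, mul_assoc (N : ℂ), Complex.exp_nat_mul]
      have hne : (S t).prod ≠ 0 := by rw [← hφS]; exact Complex.exp_ne_zero _
      rw [mul_right_comm, ← mul_pow, ← Complex.exp_add]
      simp [hne])
  have ha := angleSum_exp_neg (hS.norm_eq a) h0 h1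
  have hb := angleSum_exp_neg (hS.norm_eq b) h0 h1
  rw [hS.card_eq] at ha hb
  linarith

/-- The spectral flow is the increase of a continuous argument of the product of the eigenvalues,
minus the increase of the sum of their arguments in `[0, 2π)`. -/
theorem IsMultisetFlow.eq (hS : IsCircleFamily N S) (hφ : Continuous φ)
    (hφS : ∀ t, Complex.exp (φ t * Complex.I) = (S t).prod) {a b : ℝ} {m : ℤ}
    (h : IsMultisetFlow a b S m) :
    2 * Real.pi * m = (φ b - angleSum 1 (S b)) - (φ a - angleSum 1 (S a)) := by
  obtain ⟨K, τ, ε, rfl, rfl, hτ, hε, hne, rfl⟩ := h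
  rw [← Finset.sum_range_sub (fun k => φ (τ k) - angleSum 1 (S (τ k)))]
  push_cast
  rw [Finset.mul_sum]
  refine Finset.sum_congr rfl fun k hk => ?_
  have hk' := Finset.mem_range.1 hk
  exact hS.arcCard_sub hφ hφS (hτ k hk') (hε k hk').1 (hε k hk').2 (hne k hk')

/-- Each `S x` is finite, so it misses some `exp (iε)` with `0 < ε < π`, and continues to do so near
`x`. Compactness of `[a, b]` gives the subdivision. -/
theorem IsCircleFamily.exists_flow (hS : IsCircleFamily N S) {a b : ℝ} (hab : a ≤ b) :
    ∃ m, IsMultisetFlow a b S m := by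
  let c : Set.Ioo (0 : ℝ) Real.pi → Set (Set.Icc a b) := fun ε =>
    {t | Complex.exp ((ε : ℝ) * Complex.I) ∉ S t}
  obtain ⟨t, ht0, htm, ⟨n, hn⟩, hsub⟩ := exists_monotone_Icc_subset_open_cover_Icc hab (c := c)
    (fun ε => (hS.isOpen_notMem _).preimage continuous_subtype_val) (by
      intro x _
      obtain ⟨ε, hε, hεS⟩ : ∃ ε ∈ Set.Ioo (0 : ℝ) Real.pi,
          ε ∉ ((S x).map angle).toFinset :=
        (Set.Ioo_infinite Real.pi_pos).exists_notMem_finset _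
      refine Set.mem_iUnion.2 ⟨⟨ε, hε⟩, fun h => hεS ?_⟩
      rw [Multiset.mem_toFinset]
      convert Multiset.mem_map_of_mem angle h
      exact (angle_exp hε.1.le (by linarith [hε.2, Real.pi_pos])).symm)
  choose ε hε using hsub
  refine ⟨_, n, fun k => t k, fun k => ε k, ht0, hn n le_rfl, fun k _ => htm (Nat.le_succ k),
    fun k _ => (ε k).2, fun k _ s hs => ?_, rfl⟩
  have hs' : s ∈ Set.Icc a b := ⟨(t k).2.1.trans hs.1, hs.2.trans (t (k + 1)).2.2⟩
  exact hε k (show (⟨s, hs'⟩ : Set.Icc a b) ∈ Set.Icc (t k) (t (k + 1)) from ⟨hs.1, hs.2⟩)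

/-- When the multiplicity of `1` is constant no point crosses the cut, so both arguments of the
product are continuous and their difference stays constant. -/
theorem IsCircleFamily.sub_angleSum_eq_of_count (hS : IsCircleFamily N S) (hφ : Continuous φ)
    (hφS : ∀ t, Complex.exp (φ t * Complex.I) = (S t).prod) {a b : ℝ} (hab : a ≤ b)
    (h : ∀ t ∈ Set.Icc a b, (S t).count 1 = (S a).count 1) :
    φ b - angleSum 1 (S b) = φ a - angleSum 1 (S a) := by
  refine eq_of_exp_mul_I_eq_one (f := fun t => φ t - angleSum 1 (S t)) hab ?_ ?_
  · refine hφ.continuousOn.sub fun t ht => hS.continuousWithinAt_angleSum (by simp) ?_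
    filter_upwards [self_mem_nhdsWithin] with x hx
    rw [inv_one, h x hx, h t ht]
  · intro t ht
    push_cast
    rw [sub_mul, Complex.exp_sub, hφS, exp_angleSum (by simp) (hS.norm_eq t)]
    have hne : (S t).prod ≠ 0 := by rw [← hφS]; exact Complex.exp_ne_zero _
    simp [hne]

theorem angle_add_angle_conj {z : ℂ} (hz : ‖z‖ = 1) [Decidable (1 = z)] :
    angle z + angle (starRingEnd ℂ z) = 2 * Real.pi * (1 - (if 1 = z then 1 else 0 : ℝ)) := by
  split_ifs with h
  · simp [← h, angle_one]
  · have h0 : angle z ≠ 0 := fun h' => h (by rw [← exp_angle hz, h']; simp)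
    have h1 := (angle_nonneg z).lt_of_ne' h0
    rw [angle_eq_of_exp (z := starRingEnd ℂ z) (θ := 2 * Real.pi - angle z)
      (by linarith [angle_lt z]) (by linarith)]
    · ring
    · push_cast
      rw [sub_mul, Complex.exp_sub, Complex.exp_two_pi_mul_I, exp_angle hz, one_div,
        Complex.inv_eq_conj hz]

/-- Conjugation pairs the angle `θ` with `2π - θ`, except that `1` is paired with itself at angle
`0`. So the average angle of a point and its conjugate is `π` away from `1`. -/
theorem angleSum_of_map_conj {M : Multiset ℂ} (hM : ∀ z ∈ M, ‖z‖ = 1)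
    (hconj : M.map (starRingEnd ℂ) = M) :
    angleSum 1 M = Real.pi * (M.card - M.count 1) := by
  have key : ∀ M : Multiset ℂ, (∀ z ∈ M, ‖z‖ = 1) →
      angleSum 1 M + angleSum 1 (M.map (starRingEnd ℂ)) = 2 * Real.pi * (M.card - M.count 1) := by
    intro M hM
    induction M using Multiset.induction with
    | empty => simp [angleSum]
    | cons a M ih =>
      have h2 := ih fun z hz => hM z (Multiset.mem_cons_of_mem hz)
      have h3 := angle_add_angle_conj (hM a (Multiset.mem_cons_self _ _))
      simp only [angleSum, Multiset.map_cons, Multiset.sum_cons, Multiset.card_cons, one_mul,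
        Multiset.count_cons] at h2 ⊢
      push_cast
      linarith
  have := key M hM
  rw [hconj] at this
  linarith

/-- The product is real of modulus one, so `2φ` takes values in `2πℤ` and `φ` is constant. Only the
angle sum changes, and it is determined by the multiplicity of `1`. -/
theorem IsCircleFamily.two_mul_sub_angleSum_of_conj (hS : IsCircleFamily N S) (hφ : Continuous φ)
    (hφS : ∀ t, Complex.exp (φ t * Complex.I) = (S t).prod) {a b : ℝ} (hab : a ≤ b)
    (h : ∀ t ∈ Set.Icc a b, (S t).map (starRingEnd ℂ) = S t) :
    (φ b - angleSum 1 (S b)) - (φ a - angleSum 1 (S a)) =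
      Real.pi * ((S b).count 1 - (S a).count 1) := by
  have h1 : 2 * φ b = 2 * φ a := by
    refine eq_of_exp_mul_I_eq_one (f := fun t => 2 * φ t) hab (by fun_prop) ?_
    intro t ht
    have h2 : starRingEnd ℂ (S t).prod = (S t).prod := by
      conv_rhs => rw [← h t ht]
      exact map_multiset_prod _ _
    have h3 : ‖(S t).prod‖ = 1 := by rw [← hφS, Complex.norm_exp_ofReal_mul_I]
    push_cast
    rw [two_mul, add_mul, Complex.exp_add, hφS]
    nth_rewrite 1 [← h2]
    rw [Complex.conj_mul', h3]; simp
  rw [angleSum_of_map_conj (hS.norm_eq a) (h a (Set.left_mem_Icc.2 hab)),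
    angleSum_of_map_conj (hS.norm_eq b) (h b (Set.right_mem_Icc.2 hab)), hS.card_eq, hS.card_eq]
  linarith

/-- The product is a continuous map to the circle, which lifts through the covering `ℝ → Circle`
because `X` is simply connected. -/
theorem IsCircleFamily.exists_lift {X : Type*} [TopologicalSpace X] [SimplyConnectedSpace X]
    [LocallyPathConnectedSpace X] {S : X → Multiset ℂ} (hS : IsCircleFamily N S) :
    ∃ φ : X → ℝ, Continuous φ ∧ ∀ x, Complex.exp (φ x * Complex.I) = (S x).prod := by
  have hn : ∀ x, ‖(S x).prod‖ = 1 := by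
    intro x
    have h := map_multiset_prod (normHom : ℂ →*₀ ℝ) (S x)
    refine h.trans (Multiset.prod_eq_one fun y hy => ?_)
    obtain ⟨z, hz, rfl⟩ := Multiset.mem_map.1 hy
    exact hS.norm_eq x z hz
  -- Up to the sign `(-1) ^ N`, the product is the value at `0` of the monic polynomial.
  have hcont : Continuous fun x => (S x).prod := by
    have h := (hS.continuous_prod 0).mul (continuous_const (y := (-1 : ℂ) ^ N))
    refine h.congr fun x => ?_
    rw [← hS.card_eq x]
    have h1 : (S x).map (fun z => 0 - z) = (S x).map Neg.neg :=
      Multiset.map_congr rfl fun z _ => zero_sub z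
    change ((S x).map (fun z => 0 - z)).prod * (-1) ^ (S x).card = _
    rw [h1, Multiset.prod_map_neg, mul_right_comm, ← mul_pow]
    simp
  have hmem : ∀ x, (S x).prod ∈ Submonoid.unitSphere ℂ := fun x =>
    mem_sphere_zero_iff_norm.2 (hn x)
  let f : C(X, Circle) := ⟨fun x => ⟨(S x).prod, hmem x⟩, hcont.subtype_mk hmem⟩
  obtain ⟨x₀⟩ : Nonempty X := inferInstance
  obtain ⟨θ, hθ⟩ := Circle.exp_surjective (f x₀)
  obtain ⟨F, ⟨-, hF⟩, -⟩ := Circle.isCoveringMap_exp.existsUnique_continuousMap_lifts f x₀ θ hθ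
  refine ⟨F, F.continuous, fun x => ?_⟩
  rw [← Circle.coe_exp, ← Function.comp_apply (f := Circle.exp) (g := F), hF]
  rfl

end Flow


/-! ### Unitary matrices -/

section Unitary

variable {κ : Type*} [Fintype κ]

theorem star_dotProduct_mulVec_mulVec {l : Type*} [Fintype l] (A B : Matrix l κ ℂ) (v w : κ → ℂ) :
    star (A *ᵥ v) ⬝ᵥ (B *ᵥ w) = star v ⬝ᵥ ((Aᴴ * B) *ᵥ w) := by
  rw [Matrix.star_mulVec, ← Matrix.dotProduct_mulVec, Matrix.mulVec_mulVec]

theorem star_dotProduct_self_eq_zero {v : κ → ℂ} (h : star v ⬝ᵥ v = 0) : v = 0 := by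
  open ComplexOrder in exact dotProduct_star_self_eq_zero.1 h

variable [DecidableEq κ]

theorem star_dotProduct_mulVec_of_unitary {A : Matrix κ κ ℂ} (hA : Aᴴ * A = 1) (v w : κ → ℂ) :
    star (A *ᵥ v) ⬝ᵥ (A *ᵥ w) = star v ⬝ᵥ w := by
  rw [star_dotProduct_mulVec_mulVec, hA, Matrix.one_mulVec]

theorem norm_eq_one_of_mem_roots_charpoly {A : Matrix κ κ ℂ} (hA : Aᴴ * A = 1) {z : ℂ}
    (hz : z ∈ A.charpoly.roots) : ‖z‖ = 1 := by
  have h := Polynomial.isRoot_of_mem_roots hz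
  rw [← Matrix.charpoly_toLin', ← Module.End.hasEigenvalue_iff_isRoot_charpoly] at h
  obtain ⟨v, hv⟩ := h.exists_hasEigenvector
  have h1 : A *ᵥ v = z • v := by simpa using hv.apply_eq_smul
  have h2 := star_dotProduct_mulVec_of_unitary hA v v
  rw [h1, star_smul, smul_dotProduct, dotProduct_smul, smul_smul, smul_eq_mul] at h2
  have h3 : star v ⬝ᵥ v ≠ 0 := fun h' => hv.2 (star_dotProduct_self_eq_zero h')
  have h4 : star z * z = 1 := mul_right_cancel₀ h3 (h2.trans (one_mul _).symm)
  have h5 : (‖z‖ : ℂ) ^ 2 = 1 := by rw [← Complex.conj_mul']; exact h4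
  have h6 : ‖z‖ ^ 2 = 1 := by exact_mod_cast h5
  exact (pow_eq_one_iff_of_nonneg (norm_nonneg z) two_ne_zero).1 h6

/-- For a unitary matrix `ker (A - 1)² = ker (A - 1)`, so algebraic and geometric multiplicities
agree. -/
theorem count_one_roots_charpoly {A : Matrix κ κ ℂ} (hA : Aᴴ * A = 1) :
    A.charpoly.roots.count 1 = Module.finrank ℂ (Module.End.eigenspace (Matrix.toLin' A) 1) := by
  rw [Polynomial.count_roots, ← Matrix.charpoly_toLin', ← LinearMap.finrank_maxGenEigenspace_eq]
  suffices h : Module.End.maxGenEigenspace (Matrix.toLin' A) 1 ≤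
      Module.End.eigenspace (Matrix.toLin' A) 1 by
    rw [le_antisymm h (Module.End.genEigenspace_le_maximal (Matrix.toLin' A) 1 1)]
  -- If `y = A v - v` is fixed by `A`, then `(y, y) = (A y, A v) - (y, v) = 0` by unitarity.
  have key : ∀ v : κ → ℂ, (Matrix.toLin' A - 1) ((Matrix.toLin' A - 1) v) = 0 →
      (Matrix.toLin' A - 1) v = 0 := by
    intro v hv
    obtain ⟨y, hy⟩ : ∃ y, y = (Matrix.toLin' A - 1) v := ⟨_, rfl⟩
    rw [← hy] at hv ⊢
    simp only [LinearMap.sub_apply, Module.End.one_apply, Matrix.toLin'_apply] at hv hy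
    refine star_dotProduct_self_eq_zero ?_
    nth_rewrite 2 [hy]
    rw [dotProduct_sub]
    nth_rewrite 1 [← sub_eq_zero.1 hv]
    rw [star_dotProduct_mulVec_of_unitary hA, sub_self]
  have key2 : ∀ (k : ℕ) (v : κ → ℂ), ((Matrix.toLin' A - 1) ^ k) v = 0 →
      (Matrix.toLin' A - 1) v = 0 := by
    intro k
    induction k with
    | zero => intro v hv; rw [pow_zero, Module.End.one_apply] at hv; rw [hv, map_zero]
    | succ k ih =>
      intro v hv
      rw [pow_succ, Module.End.mul_apply] at hv
      exact key v (ih _ hv)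
  intro v hv
  obtain ⟨k, hk⟩ := Module.End.mem_genEigenspace_top.1 hv
  rw [one_smul, LinearMap.mem_ker] at hk
  have := key2 k v hk
  rw [Module.End.mem_eigenspace_iff, one_smul]
  exact sub_eq_zero.1 this

/-- The involution `B` makes `A` similar to `Aᴴ`, whose eigenvalues are the conjugates of those of
`A`. -/
theorem map_conj_roots_charpoly {A B : Matrix κ κ ℂ} (hB : B * B = 1) (h : B * A * B = Aᴴ) :
    A.charpoly.roots.map (starRingEnd ℂ) = A.charpoly.roots := by
  rw [← (IsAlgClosed.splits A.charpoly).roots_map (starRingEnd ℂ), ← Matrix.charpoly_map,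
    ← Matrix.charpoly_transpose]
  have h1 : (A.map (starRingEnd ℂ))ᵀ = Aᴴ := rfl
  rw [h1, ← h, Matrix.charpoly_mul_comm, ← mul_assoc, hB, one_mul]

theorem isCircleFamily_charpoly {X : Type*} [TopologicalSpace X] {A : X → Matrix κ κ ℂ}
    (hc : Continuous A) (hA : ∀ x, (A x)ᴴ * A x = 1) :
    IsCircleFamily (Fintype.card κ) (fun x => (A x).charpoly.roots) where
  card_eq x := by
    rw [← (IsAlgClosed.splits (A x).charpoly).natDegree_eq_card_roots,
      Matrix.charpoly_natDegree_eq_dim]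
  norm_eq x z hz := norm_eq_one_of_mem_roots_charpoly (hA x) hz
  continuous_prod w := by
    have h : ∀ x, ((A x).charpoly.roots.map (fun z => w - z)).prod =
        (Matrix.scalar κ w - A x).det := by
      intro x
      rw [← Matrix.eval_charpoly]
      conv_rhs => rw [(IsAlgClosed.splits (A x).charpoly).eq_prod_roots_of_monic
        (Matrix.charpoly_monic _)]
      simp [Polynomial.eval_multiset_prod, Multiset.map_map]
    simp only [h]
    exact (continuous_const.sub hc).matrix_det

theorem continuous_matrix_inv {X : Type*} [TopologicalSpace X] {A : X → Matrix κ κ ℂ}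
    (hc : Continuous A) (hA : ∀ x, IsUnit (A x)) : Continuous fun x => (A x)⁻¹ := by
  simp only [Matrix.inv_def, Ring.inverse_eq_inv']
  exact (hc.matrix_det.inv₀ fun x => ((Matrix.isUnit_iff_isUnit_det _).1 (hA x)).ne_zero).smul
    hc.matrix_adjugate

end Unitary

/-! ### Spectral flow in terms of the multiset of eigenvalues -/

section SpectralFlow

variable {E : Type*} [AddCommGroup E] [Module ℂ E] [Module.Finite ℂ E]

theorem isSpectralFlow_iff {a b : ℝ} {A : ℝ → Module.End ℂ E} {S : ℝ → Multiset ℂ}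
    (h : ∀ t ∈ Set.Icc a b, (A t).charpoly.roots = S t) (m : ℤ) :
    IsSpectralFlow a b A m ↔ IsMultisetFlow a b S m := by
  have harc : ∀ (t ε : ℝ), t ∈ Set.Icc a b → arcCount (A t) ε = arcCard (S t) ε := by
    intro t ε ht
    rw [← h t ht]
    rfl
  have heig : ∀ (t : ℝ) (z : ℂ), t ∈ Set.Icc a b → ((A t).HasEigenvalue z ↔ z ∈ S t) := by
    intro t z ht
    rw [← h t ht, Module.End.hasEigenvalue_iff_isRoot_charpoly,
      Polynomial.mem_roots (LinearMap.charpoly_monic _).ne_zero]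
  have key : ∀ (N : ℕ) (τ : ℕ → ℝ), τ 0 = a → τ N = b → (∀ k < N, τ k ≤ τ (k + 1)) →
      ∀ k ≤ N, τ k ∈ Set.Icc a b := by
    rintro N τ rfl rfl hτ k hk
    have mono : ∀ i j, i ≤ j → j ≤ N → τ i ≤ τ j := by
      intro i j hij
      induction j, hij using Nat.le_induction with
      | base => exact fun _ => le_rfl
      | succ j _ ih => exact fun hj => (ih (by omega)).trans (hτ j (by omega))
    exact ⟨mono 0 k (Nat.zero_le k) hk, mono k N hk le_rfl⟩
  refine exists_congr fun N => exists_congr fun τ => exists_congr fun ε => ?_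
  refine and_congr_right fun h0 => and_congr_right fun hN => and_congr_right fun hτ =>
    and_congr_right fun _ => and_congr ?_ ?_
  · refine forall₂_congr fun k hk => forall₂_congr fun t ht => not_congr (heig t _ ?_)
    exact ⟨(key N τ h0 hN hτ k hk.le).1.trans ht.1, ht.2.trans (key N τ h0 hN hτ _ hk).2⟩
  · rw [Finset.sum_congr rfl fun k hk => ?_]
    have hk' := Finset.mem_range.1 hk
    rw [harc _ _ (key N τ h0 hN hτ k hk'.le), harc _ _ (key N τ h0 hN hτ _ hk')]

end SpectralFlow


/-! ### Lagrangian subspaces and unitary matrices -/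

section Lagrangian

variable {ι : Type*} [DecidableEq ι]

/-- The matrix of `(x, y, z, u) ↦ (x - c y, z + c u)`. For `c = ±i` it gives the component in the
eigenspace of `diag (-J, J)` for the eigenvalue `c`. -/
def eigenMatrix (ι : Type*) [DecidableEq ι] (c : ℂ) : Matrix (ι ⊕ ι) ((ι ⊕ ι) ⊕ (ι ⊕ ι)) ℂ :=
  Matrix.fromBlocks (Matrix.fromCols 1 (-c • (1 : Matrix ι ι ℂ))) 0 0
    (Matrix.fromCols 1 (c • (1 : Matrix ι ι ℂ)))

/-- The matrix of `diag (-J, J)`. -/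
def doubleJMatrix (ι : Type*) [DecidableEq ι] : Matrix ((ι ⊕ ι) ⊕ (ι ⊕ ι)) ((ι ⊕ ι) ⊕ (ι ⊕ ι)) ℂ :=
  Matrix.fromBlocks (-(Matrix.J ι ℂ)) 0 0 (Matrix.J ι ℂ)

/-- The matrix of `(x, y, z, u) ↦ (x, -y, z, -u)`. -/
def flipMatrix (ι : Type*) [DecidableEq ι] : Matrix ((ι ⊕ ι) ⊕ (ι ⊕ ι)) ((ι ⊕ ι) ⊕ (ι ⊕ ι)) ℂ :=
  Matrix.fromBlocks (Matrix.fromBlocks 1 0 0 (-1)) 0 0 (Matrix.fromBlocks 1 0 0 (-1))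

theorem conjTranspose_eigenMatrix (c : ℂ) : (eigenMatrix ι c)ᴴ =
    Matrix.fromBlocks (Matrix.fromRows 1 (-star c • (1 : Matrix ι ι ℂ))) 0 0
      (Matrix.fromRows 1 (star c • (1 : Matrix ι ι ℂ))) := by
  simp only [eigenMatrix, Matrix.fromBlocks_conjTranspose,
    Matrix.conjTranspose_fromCols_eq_fromRows_conjTranspose, Matrix.conjTranspose_one,
    Matrix.conjTranspose_smul, Matrix.conjTranspose_zero, star_neg]

variable [Fintype ι]

theorem eigenMatrix_mul_doubleJMatrix {c : ℂ} (hc : c * c = -1) :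
    eigenMatrix ι c * doubleJMatrix ι = c • eigenMatrix ι c := by
  simp only [eigenMatrix, doubleJMatrix, Matrix.J, Matrix.fromBlocks_neg,
    Matrix.fromBlocks_multiply, Matrix.fromCols_mul_fromBlocks, Matrix.fromBlocks_smul]
  ext (i | i) ((j | j) | (j | j)) <;> simp [← mul_assoc, hc]

/-- The flip anticommutes with `diag (-J, J)`, so it exchanges the two eigenspaces. -/
theorem eigenMatrix_mul_flipMatrix (c : ℂ) :
    eigenMatrix ι c * flipMatrix ι = eigenMatrix ι (-c) := by
  simp only [eigenMatrix, flipMatrix,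
    Matrix.fromBlocks_multiply, Matrix.fromCols_mul_fromBlocks]
  ext (i | i) ((j | j) | (j | j)) <;> simp

theorem eigenMatrix_mul_conjTranspose (c d : ℂ) :
    eigenMatrix ι c * (eigenMatrix ι d)ᴴ = (1 + c * star d) • (1 : Matrix (ι ⊕ ι) (ι ⊕ ι) ℂ) := by
  rw [conjTranspose_eigenMatrix]
  simp only [eigenMatrix, Matrix.fromBlocks_multiply, Matrix.fromCols_mul_fromRows]
  ext (i | i) (j | j) <;> simp [Matrix.one_apply] <;> split_ifs <;> simp [mul_comm]

/-- Half of each summand is the orthogonal projection onto an eigenspace of `diag (-J, J)`. This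
identity and the next one express the spectral decomposition of that operator. -/
theorem conjTranspose_mul_eigenMatrix_add :
    (eigenMatrix ι Complex.I)ᴴ * eigenMatrix ι Complex.I +
      (eigenMatrix ι (-Complex.I))ᴴ * eigenMatrix ι (-Complex.I) =
    (2 : ℂ) • (1 : Matrix ((ι ⊕ ι) ⊕ (ι ⊕ ι)) ((ι ⊕ ι) ⊕ (ι ⊕ ι)) ℂ) := by
  simp only [conjTranspose_eigenMatrix]
  simp only [eigenMatrix, Matrix.fromBlocks_multiply, Matrix.fromRows_mul_fromCols]
  ext ((i | i) | (i | i)) ((j | j) | (j | j)) <;>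
    simp [Matrix.one_apply] <;> split_ifs <;> norm_num

theorem conjTranspose_mul_eigenMatrix_sub :
    (eigenMatrix ι Complex.I)ᴴ * eigenMatrix ι Complex.I -
      (eigenMatrix ι (-Complex.I))ᴴ * eigenMatrix ι (-Complex.I) =
    (-2 * Complex.I) • doubleJMatrix ι := by
  have h := congrArg (· * doubleJMatrix ι) (conjTranspose_mul_eigenMatrix_add (ι := ι))
  simp only [Matrix.add_mul, Matrix.mul_assoc,
    eigenMatrix_mul_doubleJMatrix (ι := ι) (c := Complex.I) (by simp),
    eigenMatrix_mul_doubleJMatrix (ι := ι) (c := -Complex.I) (by simp), Matrix.mul_smul,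
    Matrix.smul_mul, Matrix.one_mul] at h
  have h2 := congrArg (fun M => -Complex.I • M) h
  simp only [smul_add, smul_smul] at h2
  rw [neg_mul, ← mul_neg, mul_comm, ← h2]
  simp [sub_eq_add_neg]

/-- `Λ` is the graph of the unitary map with matrix `V` from `ker (j - i)` onto `ker (j + i)`,
`j = diag (-J, J)`, both identified with `ℂ^{2n}`. -/
structure IsUnitaryMatrixOf (Λ : Submodule ℂ (EuclideanSpace ℂ ((ι ⊕ ι) ⊕ (ι ⊕ ι))))
    (V : Matrix (ι ⊕ ι) (ι ⊕ ι) ℂ) : Prop where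
  unitary : Vᴴ * V = 1
  mem_iff : ∀ w, w ∈ Λ ↔
    eigenMatrix ι (-Complex.I) *ᵥ w.ofLp = V *ᵥ (eigenMatrix ι Complex.I *ᵥ w.ofLp)

/-- The columns of `Z` are a basis of the Lagrangian subspace `Λ`. -/
structure IsLagrangianFrame (Λ : Submodule ℂ (EuclideanSpace ℂ ((ι ⊕ ι) ⊕ (ι ⊕ ι))))
    (Z : Matrix ((ι ⊕ ι) ⊕ (ι ⊕ ι)) (ι ⊕ ι) ℂ) : Prop where
  mem_iff : ∀ w, w ∈ Λ ↔ ∃ v, w.ofLp = Z *ᵥ v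
  isotropic : Zᴴ * doubleJMatrix ι * Z = 0
  eq_zero : ∀ v, Z *ᵥ v = 0 → v = 0

/-- The matrix of the unitary map whose graph is the range of the Lagrangian frame `Z`. -/
noncomputable def frameUnitary (Z : Matrix ((ι ⊕ ι) ⊕ (ι ⊕ ι)) (ι ⊕ ι) ℂ) :
    Matrix (ι ⊕ ι) (ι ⊕ ι) ℂ :=
  (eigenMatrix ι (-Complex.I) * Z) * (eigenMatrix ι Complex.I * Z)⁻¹

theorem eq_of_eigenMatrix_mulVec_eq {w w' : (ι ⊕ ι) ⊕ (ι ⊕ ι) → ℂ}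
    (h₁ : eigenMatrix ι Complex.I *ᵥ w = eigenMatrix ι Complex.I *ᵥ w')
    (h₂ : eigenMatrix ι (-Complex.I) *ᵥ w = eigenMatrix ι (-Complex.I) *ᵥ w') : w = w' := by
  have h : ∀ w : (ι ⊕ ι) ⊕ (ι ⊕ ι) → ℂ, (2 : ℂ) • w =
      (eigenMatrix ι Complex.I)ᴴ *ᵥ (eigenMatrix ι Complex.I *ᵥ w) +
      (eigenMatrix ι (-Complex.I))ᴴ *ᵥ (eigenMatrix ι (-Complex.I) *ᵥ w) := by
    intro w
    rw [Matrix.mulVec_mulVec, Matrix.mulVec_mulVec, ← Matrix.add_mulVec,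
      conjTranspose_mul_eigenMatrix_add, Matrix.smul_mulVec, Matrix.one_mulVec]
  have h2 : (2 : ℂ) • w = (2 : ℂ) • w' := by rw [h w, h w', h₁, h₂]
  exact smul_right_injective _ two_ne_zero h2

namespace IsLagrangianFrame

variable {Λ : Submodule ℂ (EuclideanSpace ℂ ((ι ⊕ ι) ⊕ (ι ⊕ ι)))}
  {Z : Matrix ((ι ⊕ ι) ⊕ (ι ⊕ ι)) (ι ⊕ ι) ℂ}

/-- Isotropy means that the components in the two eigenspaces have the same Gram matrix.
Invertibility and unitarity in the next two lemmas both come from this. -/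
theorem conjTranspose_mul_self_eq (h : IsLagrangianFrame Λ Z) :
    (eigenMatrix ι Complex.I * Z)ᴴ * (eigenMatrix ι Complex.I * Z) =
      (eigenMatrix ι (-Complex.I) * Z)ᴴ * (eigenMatrix ι (-Complex.I) * Z) := by
  have h1 : Zᴴ * ((eigenMatrix ι Complex.I)ᴴ * eigenMatrix ι Complex.I -
      (eigenMatrix ι (-Complex.I))ᴴ * eigenMatrix ι (-Complex.I)) * Z = 0 := by
    rw [conjTranspose_mul_eigenMatrix_sub, Matrix.mul_smul, Matrix.smul_mul, h.isotropic, smul_zero]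
  simp only [Matrix.mul_sub, Matrix.sub_mul, sub_eq_zero, Matrix.mul_assoc] at h1
  simpa only [Matrix.conjTranspose_mul, Matrix.mul_assoc] using h1

theorem isUnit_eigenMatrix_mul (h : IsLagrangianFrame Λ Z) :
    IsUnit (eigenMatrix ι Complex.I * Z) := by
  rw [← Matrix.mulVec_injective_iff_isUnit]
  refine (injective_iff_map_eq_zero (Matrix.mulVecLin _)).2 fun v hv => ?_
  rw [Matrix.mulVecLin_apply] at hv
  have h1 : (eigenMatrix ι (-Complex.I) * Z) *ᵥ v = 0 := by
    refine star_dotProduct_self_eq_zero ?_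
    rw [star_dotProduct_mulVec_mulVec, ← h.conjTranspose_mul_self_eq,
      ← star_dotProduct_mulVec_mulVec, hv, dotProduct_zero]
  rw [← Matrix.mulVec_mulVec] at h1 hv
  exact h.eq_zero v (eq_of_eigenMatrix_mulVec_eq (hv.trans (Matrix.mulVec_zero _).symm)
    (h1.trans (Matrix.mulVec_zero _).symm))

theorem isUnitaryMatrixOf (h : IsLagrangianFrame Λ Z) : IsUnitaryMatrixOf Λ (frameUnitary Z) := by
  have hu := h.isUnit_eigenMatrix_mul
  have hdet := (Matrix.isUnit_iff_isUnit_det _).1 hu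
  constructor
  · rw [frameUnitary, Matrix.conjTranspose_mul, Matrix.mul_assoc,
      ← Matrix.mul_assoc (eigenMatrix ι (-Complex.I) * Z)ᴴ, ← h.conjTranspose_mul_self_eq,
      Matrix.mul_assoc, Matrix.mul_nonsing_inv _ hdet, Matrix.mul_one, ← Matrix.conjTranspose_mul,
      Matrix.mul_nonsing_inv _ hdet, Matrix.conjTranspose_one]
  · intro w
    rw [h.mem_iff]
    constructor
    · rintro ⟨v, hv⟩
      rw [hv, frameUnitary, Matrix.mulVec_mulVec, Matrix.mulVec_mulVec, Matrix.mulVec_mulVec,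
        Matrix.mul_assoc _ _ Z, Matrix.mul_assoc, Matrix.nonsing_inv_mul _ hdet, Matrix.mul_one]
    · intro hw
      refine ⟨(eigenMatrix ι Complex.I * Z)⁻¹ *ᵥ (eigenMatrix ι Complex.I *ᵥ w.ofLp),
        eq_of_eigenMatrix_mulVec_eq ?_ ?_⟩
      · rw [Matrix.mulVec_mulVec _ _ Z, Matrix.mulVec_mulVec, Matrix.mulVec_mulVec,
          Matrix.mul_nonsing_inv _ hdet, Matrix.one_mul]
      · rw [hw, frameUnitary]
        simp only [Matrix.mulVec_mulVec, Matrix.mul_assoc]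

end IsLagrangianFrame

theorem continuous_frameUnitary {X : Type*} [TopologicalSpace X]
    {Z : X → Matrix ((ι ⊕ ι) ⊕ (ι ⊕ ι)) (ι ⊕ ι) ℂ} (hZ : Continuous Z)
    {Λ : X → Submodule ℂ (EuclideanSpace ℂ ((ι ⊕ ι) ⊕ (ι ⊕ ι)))}
    (h : ∀ x, IsLagrangianFrame (Λ x) (Z x)) : Continuous fun x => frameUnitary (Z x) :=
  (continuous_const.matrix_mul hZ).matrix_mul (continuous_matrix_inv
    (continuous_const.matrix_mul hZ) fun x => (h x).isUnit_eigenMatrix_mul)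

namespace IsUnitaryMatrixOf

variable {Λ Λ' : Submodule ℂ (EuclideanSpace ℂ ((ι ⊕ ι) ⊕ (ι ⊕ ι)))}
  {V V' : Matrix (ι ⊕ ι) (ι ⊕ ι) ℂ}

theorem mul_conjTranspose (h : IsUnitaryMatrixOf Λ V) : V * Vᴴ = 1 :=
  mul_eq_one_comm.1 h.unitary

/-- Every vector is the `ker (j - i)`-component of an element of `Λ`. -/
theorem exists_mem (h : IsUnitaryMatrixOf Λ V) (f : ι ⊕ ι → ℂ) :
    ∃ w ∈ Λ, eigenMatrix ι Complex.I *ᵥ w.ofLp = f ∧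
      eigenMatrix ι (-Complex.I) *ᵥ w.ofLp = V *ᵥ f := by
  obtain ⟨w, hw⟩ : ∃ w : EuclideanSpace ℂ ((ι ⊕ ι) ⊕ (ι ⊕ ι)), w.ofLp = (2⁻¹ : ℂ) •
      ((eigenMatrix ι Complex.I)ᴴ *ᵥ f + (eigenMatrix ι (-Complex.I))ᴴ *ᵥ (V *ᵥ f)) :=
    ⟨WithLp.toLp 2 _, rfl⟩
  have h1 : eigenMatrix ι Complex.I *ᵥ w.ofLp = f := by
    rw [hw, Matrix.mulVec_smul, Matrix.mulVec_add, Matrix.mulVec_mulVec, Matrix.mulVec_mulVec,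
      eigenMatrix_mul_conjTranspose, eigenMatrix_mul_conjTranspose]
    norm_num [Matrix.smul_mulVec, smul_smul]
  have h2 : eigenMatrix ι (-Complex.I) *ᵥ w.ofLp = V *ᵥ f := by
    rw [hw, Matrix.mulVec_smul, Matrix.mulVec_add, Matrix.mulVec_mulVec, Matrix.mulVec_mulVec,
      eigenMatrix_mul_conjTranspose, eigenMatrix_mul_conjTranspose]
    norm_num [Matrix.smul_mulVec, smul_smul]
  exact ⟨w, (h.mem_iff w).2 (h2.trans (congrArg _ h1.symm)), h1, h2⟩

/-- The flip exchanges the two components, so with `(f, V f)` the graph also contains `(V f, f)`. -/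
theorem mul_self_of_flip (h : IsUnitaryMatrixOf Λ V)
    (hflip : ∀ w ∈ Λ, WithLp.toLp 2 (flipMatrix ι *ᵥ w.ofLp) ∈ Λ) : V * V = 1 := by
  suffices key : ∀ f, (V * V) *ᵥ f = 1 *ᵥ f from Matrix.ext_of_mulVec_single fun i => key _
  intro f
  obtain ⟨w, hw, h1, h2⟩ := h.exists_mem f
  have h3 := (h.mem_iff _).1 (hflip w hw)
  simp only [Matrix.mulVec_mulVec, eigenMatrix_mul_flipMatrix, neg_neg] at h3
  rw [Matrix.one_mulVec, ← Matrix.mulVec_mulVec, ← h2, Matrix.mulVec_mulVec, ← h3, h1]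

/-- Taking the `ker (j - i)`-component identifies the intersection with `{f | V f = V' f}`, the
fixed space of `V'ᴴ V`. -/
theorem finrank_inf (h : IsUnitaryMatrixOf Λ V) (h' : IsUnitaryMatrixOf Λ' V') :
    Module.finrank ℂ ↥(Λ ⊓ Λ') = (V'ᴴ * V).charpoly.roots.count 1 := by
  have hu : (V'ᴴ * V)ᴴ * (V'ᴴ * V) = 1 := by
    rw [Matrix.conjTranspose_mul, Matrix.conjTranspose_conjTranspose, Matrix.mul_assoc,
      ← Matrix.mul_assoc V', h'.mul_conjTranspose, Matrix.one_mul, h.unitary]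
  have hiff : ∀ f : ι ⊕ ι → ℂ, (V'ᴴ * V) *ᵥ f = f ↔ V *ᵥ f = V' *ᵥ f := by
    intro f
    constructor
    · intro hf
      have := congrArg (V' *ᵥ ·) hf
      simpa only [Matrix.mulVec_mulVec, ← Matrix.mul_assoc, h'.mul_conjTranspose,
        Matrix.one_mul] using this
    · intro hf
      rw [← Matrix.mulVec_mulVec, hf, Matrix.mulVec_mulVec, h'.unitary, Matrix.one_mulVec]
  rw [count_one_roots_charpoly hu]
  let g : ↥(Λ ⊓ Λ') →ₗ[ℂ] (ι ⊕ ι → ℂ) := (eigenMatrix ι Complex.I).mulVecLin ∘ₗ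
    (WithLp.linearEquiv 2 ℂ _).toLinearMap ∘ₗ (Λ ⊓ Λ').subtype
  have hg : ∀ w, g w = eigenMatrix ι Complex.I *ᵥ (w : EuclideanSpace ℂ _).ofLp := fun _ => rfl
  have hinj : Function.Injective g := by
    intro w w' hww
    rw [hg, hg] at hww
    refine Subtype.ext (PiLp.ext fun i => congrFun (eq_of_eigenMatrix_mulVec_eq hww ?_) i)
    rw [(h.mem_iff _).1 w.2.1, (h.mem_iff _).1 w'.2.1, hww]
  rw [← LinearMap.finrank_range_of_inj hinj]
  congr 2
  all_goals
    ext f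
    rw [LinearMap.mem_range, Module.End.mem_eigenspace_iff, one_smul, Matrix.toLin'_apply, hiff]
    constructor
    · rintro ⟨w, rfl⟩
      rw [hg, ← (h.mem_iff _).1 w.2.1, (h'.mem_iff _).1 w.2.2]
    · intro hf
      obtain ⟨w, hw, h1, h2⟩ := h.exists_mem f
      refine ⟨⟨w, hw, (h'.mem_iff _).2 ?_⟩, h1⟩
      rw [h1, h2, hf]

end IsUnitaryMatrixOf

end Lagrangian


/-! ### Unitary maps between the eigenspaces in matrix coordinates -/

section UnitaryMaps

variable {ι : Type*} [Fintype ι] [DecidableEq ι]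

theorem ofLp_doubleJ (x : EuclideanSpace ℂ ((ι ⊕ ι) ⊕ (ι ⊕ ι))) :
    (doubleJ ι x).ofLp = doubleJMatrix ι *ᵥ x.ofLp := rfl

theorem eigenMatrix_neg_mulVec_eq_zero {c : ℂ} (hc : c * c = -1)
    (x : Module.End.eigenspace (doubleJ ι) c) :
    eigenMatrix ι (-c) *ᵥ (x : EuclideanSpace ℂ _).ofLp = 0 := by
  have h := congrArg WithLp.ofLp (Module.End.mem_eigenspace_iff.1 x.2)
  rw [ofLp_doubleJ, WithLp.ofLp_smul] at h
  have h1 := congrArg (eigenMatrix ι (-c) *ᵥ ·) h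
  simp only [Matrix.mulVec_mulVec, eigenMatrix_mul_doubleJMatrix (ι := ι) (c := -c) (by simpa),
    Matrix.mulVec_smul, Matrix.smul_mulVec] at h1
  have h2 : (2 * c) • (eigenMatrix ι (-c) *ᵥ (x : EuclideanSpace ℂ _).ofLp) = 0 := by
    rw [two_mul, add_smul]
    nth_rewrite 1 [← h1]
    rw [neg_smul, neg_add_cancel]
  have hc0 : c ≠ 0 := by rintro rfl; simp at hc
  exact (smul_eq_zero.1 h2).resolve_left (by simpa using hc0)

theorem doubleJMatrix_mul_conjTranspose {c : ℂ} (hc : c * c = -1) (hc' : star c = -c) :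
    doubleJMatrix ι * (eigenMatrix ι c)ᴴ = c • (eigenMatrix ι c)ᴴ := by
  have hJ : (doubleJMatrix ι)ᴴ = -doubleJMatrix ι := by
    simp [doubleJMatrix, Matrix.J, Matrix.fromBlocks_conjTranspose, Matrix.fromBlocks_neg]
  have h := congrArg Matrix.conjTranspose (eigenMatrix_mul_doubleJMatrix (ι := ι) hc)
  rw [Matrix.conjTranspose_mul, hJ, Matrix.conjTranspose_smul, hc', Matrix.neg_mul, neg_smul] at h
  exact neg_injective h

/-- The eigenspace of `diag (-J, J)` for the eigenvalue `c = ±i` is isomorphic to `ℂ^{2n}`. -/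
noncomputable def eigenspaceEquiv {c : ℂ} (hc : c * c = -1) (hc' : star c = -c) :
    Module.End.eigenspace (doubleJ ι) c ≃ₗ[ℂ] (ι ⊕ ι → ℂ) where
  toFun x := eigenMatrix ι c *ᵥ (x : EuclideanSpace ℂ _).ofLp
  map_add' x y := by simp [Matrix.mulVec_add]
  map_smul' a x := by simp [Matrix.mulVec_smul]
  invFun f := ⟨WithLp.toLp 2 ((2⁻¹ : ℂ) • ((eigenMatrix ι c)ᴴ *ᵥ f)), by
    rw [Module.End.mem_eigenspace_iff]
    refine PiLp.ext fun i => congrFun (?_ : (_ : (ι ⊕ ι) ⊕ (ι ⊕ ι) → ℂ) = _) i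
    rw [ofLp_doubleJ, WithLp.ofLp_smul, Matrix.mulVec_smul, Matrix.mulVec_mulVec,
      doubleJMatrix_mul_conjTranspose hc hc', Matrix.smul_mulVec, smul_comm]⟩
  left_inv x := by
    refine Subtype.ext (PiLp.ext fun i => congrFun (?_ : (_ : (ι ⊕ ι) ⊕ (ι ⊕ ι) → ℂ) = _) i)
    have h0 : c = Complex.I ∨ c = -Complex.I := by
      have : (c - Complex.I) * (c + Complex.I) = 0 := by
        linear_combination hc - Complex.I_mul_I
      rcases mul_eq_zero.1 this with h | h
      · exact Or.inl (sub_eq_zero.1 h)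
      · exact Or.inr (eq_neg_of_add_eq_zero_left h)
    have hz := eigenMatrix_neg_mulVec_eq_zero hc x
    have h := congrArg (· *ᵥ (x : EuclideanSpace ℂ _).ofLp)
      (conjTranspose_mul_eigenMatrix_add (ι := ι))
    simp only [Matrix.add_mulVec, ← Matrix.mulVec_mulVec, Matrix.smul_mulVec,
      Matrix.one_mulVec] at h
    rcases h0 with rfl | rfl
    · rw [hz, Matrix.mulVec_zero, add_zero] at h
      simp [h]
    · rw [neg_neg] at hz
      rw [hz, Matrix.mulVec_zero, zero_add] at h
      simp [h]
  right_inv f := by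
    change eigenMatrix ι c *ᵥ ((2⁻¹ : ℂ) • ((eigenMatrix ι c)ᴴ *ᵥ f)) = f
    have : (1 : ℂ) + c * -c = 2 := by linear_combination -hc
    rw [Matrix.mulVec_smul, Matrix.mulVec_mulVec, eigenMatrix_mul_conjTranspose, hc', this]
    simp [Matrix.smul_mulVec]

theorem eigenspaceEquiv_apply {c : ℂ} (hc : c * c = -1) (hc' : star c = -c)
    (x : Module.End.eigenspace (doubleJ ι) c) :
    eigenspaceEquiv hc hc' x = eigenMatrix ι c *ᵥ (x : EuclideanSpace ℂ _).ofLp := rfl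

/-- The coordinates scale norms by the same factor `√2` on both eigenspaces, so isometries between
them correspond to unitary matrices. -/
theorem star_dotProduct_eigenspaceEquiv {c : ℂ} (hc : c * c = -1) (hc' : star c = -c)
    (x : Module.End.eigenspace (doubleJ ι) c) :
    star (eigenspaceEquiv hc hc' x) ⬝ᵥ eigenspaceEquiv hc hc' x = 2 * (‖x‖ : ℂ) ^ 2 := by
  have h : ((eigenspaceEquiv hc hc').symm (eigenspaceEquiv hc hc' x) : EuclideanSpace ℂ _).ofLp =
      (2⁻¹ : ℂ) • ((eigenMatrix ι c)ᴴ *ᵥ (eigenspaceEquiv hc hc' x)) := rfl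
  rw [LinearEquiv.symm_apply_apply, eigenspaceEquiv_apply, Matrix.mulVec_mulVec] at h
  have h2 : (‖x‖ : ℂ) ^ 2 =
      star x.1.ofLp ⬝ᵥ x.1.ofLp := by
    have := inner_self_eq_norm_sq_to_K (𝕜 := ℂ) x.1
    rw [EuclideanSpace.inner_eq_star_dotProduct, dotProduct_comm] at this
    exact this.symm
  rw [h2, eigenspaceEquiv_apply, star_dotProduct_mulVec_mulVec]
  nth_rewrite 4 [h]
  simp [dotProduct_smul]

theorem I_mul_I_eq : Complex.I * Complex.I = -1 := Complex.I_mul_I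

theorem star_I_eq : star Complex.I = -Complex.I := Complex.conj_I

theorem neg_I_mul_neg_I_eq : -Complex.I * -Complex.I = -1 := by simp

theorem star_neg_I_eq : star (-Complex.I) = - -Complex.I := by simp

variable {Λ Λ' : Submodule ℂ (EuclideanSpace ℂ ((ι ⊕ ι) ⊕ (ι ⊕ ι)))}
  {V V' : Matrix (ι ⊕ ι) (ι ⊕ ι) ℂ}

namespace IsUnitaryMatrixOf

theorem isGraphOf_iff (h : IsUnitaryMatrixOf Λ V) (U : UnitaryMaps (doubleJ ι)) :
    IsGraphOf (doubleJ ι) Λ U ↔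
      ∀ x, eigenspaceEquiv neg_I_mul_neg_I_eq star_neg_I_eq (U x) =
        V *ᵥ eigenspaceEquiv I_mul_I_eq star_I_eq x := by
  have h1 : ∀ x : Module.End.eigenspace (doubleJ ι) Complex.I,
      eigenMatrix ι Complex.I *ᵥ ((x : EuclideanSpace ℂ _) + (U x : EuclideanSpace ℂ _)).ofLp =
        eigenspaceEquiv I_mul_I_eq star_I_eq x := by
    intro x
    have := eigenMatrix_neg_mulVec_eq_zero neg_I_mul_neg_I_eq (U x)
    rw [neg_neg] at this
    rw [WithLp.ofLp_add, Matrix.mulVec_add, this, add_zero, eigenspaceEquiv_apply]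
  have h2 : ∀ x : Module.End.eigenspace (doubleJ ι) Complex.I,
      eigenMatrix ι (-Complex.I) *ᵥ ((x : EuclideanSpace ℂ _) + (U x : EuclideanSpace ℂ _)).ofLp =
        eigenspaceEquiv neg_I_mul_neg_I_eq star_neg_I_eq (U x) := by
    intro x
    have := eigenMatrix_neg_mulVec_eq_zero I_mul_I_eq x
    rw [WithLp.ofLp_add, Matrix.mulVec_add, this, zero_add, eigenspaceEquiv_apply]
  constructor
  · intro hU x
    have := (h.mem_iff _).1 ((hU _).2 ⟨x, rfl⟩)
    rwa [h1, h2] at this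
  · intro hU z
    rw [h.mem_iff]
    constructor
    · intro hz
      refine ⟨(eigenspaceEquiv I_mul_I_eq star_I_eq).symm (eigenMatrix ι Complex.I *ᵥ z.ofLp), ?_⟩
      refine PiLp.ext fun i => congrFun (eq_of_eigenMatrix_mulVec_eq ?_ ?_) i
      · rw [h1, LinearEquiv.apply_symm_apply]
      · rw [h2, hU, LinearEquiv.apply_symm_apply, hz]
    · rintro ⟨x, rfl⟩
      rw [h1, h2, hU]

theorem exists_isGraphOf (h : IsUnitaryMatrixOf Λ V) :
    ∃ U : UnitaryMaps (doubleJ ι), IsGraphOf (doubleJ ι) Λ U := by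
  let e : Module.End.eigenspace (doubleJ ι) Complex.I ≃ₗ[ℂ]
      Module.End.eigenspace (doubleJ ι) (-Complex.I) :=
    (eigenspaceEquiv I_mul_I_eq star_I_eq).trans
      ((Matrix.toLin'OfInv h.unitary h.mul_conjTranspose).trans
        (eigenspaceEquiv neg_I_mul_neg_I_eq star_neg_I_eq).symm)
  have he : ∀ x, eigenspaceEquiv neg_I_mul_neg_I_eq star_neg_I_eq (e x) =
      V *ᵥ eigenspaceEquiv I_mul_I_eq star_I_eq x := fun x =>
    (LinearEquiv.apply_symm_apply _ _).trans (Matrix.toLin'_apply V _)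
  refine ⟨⟨e, fun x => ?_⟩, (h.isGraphOf_iff _).2 he⟩
  have h1 := star_dotProduct_eigenspaceEquiv neg_I_mul_neg_I_eq star_neg_I_eq (e x)
  rw [he, star_dotProduct_mulVec_of_unitary h.unitary, star_dotProduct_eigenspaceEquiv] at h1
  have h2 : (‖x‖ : ℂ) ^ 2 = (‖e x‖ : ℂ) ^ 2 := mul_left_cancel₀ two_ne_zero h1
  have h3 : ‖x‖ ^ 2 = ‖e x‖ ^ 2 := by exact_mod_cast h2
  exact ((pow_left_inj₀ (norm_nonneg _) (norm_nonneg _) two_ne_zero).1 h3).symm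

theorem charpoly_eq (h : IsUnitaryMatrixOf Λ V) (h' : IsUnitaryMatrixOf Λ' V')
    {U U' : UnitaryMaps (doubleJ ι)} (hU : IsGraphOf (doubleJ ι) Λ U)
    (hU' : IsGraphOf (doubleJ ι) Λ' U') :
    (((U.trans U'.symm).toLinearEquiv :
      Module.End ℂ (Module.End.eigenspace (doubleJ ι) Complex.I))).charpoly =
      (V'ᴴ * V).charpoly := by
  rw [← Matrix.charpoly_toLin',
    ← LinearEquiv.charpoly_conj (eigenspaceEquiv (ι := ι) I_mul_I_eq star_I_eq)]
  congr 1
  refine LinearMap.ext fun f => ?_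
  obtain ⟨x, rfl⟩ := (eigenspaceEquiv (ι := ι) I_mul_I_eq star_I_eq).surjective f
  rw [LinearEquiv.conj_apply_apply, LinearEquiv.symm_apply_apply, Matrix.toLin'_apply,
    ← Matrix.mulVec_mulVec, ← (h.isGraphOf_iff U).1 hU x]
  have h1 := (h'.isGraphOf_iff U').1 hU' (U'.symm (U x))
  rw [LinearIsometryEquiv.apply_symm_apply] at h1
  rw [h1, Matrix.mulVec_mulVec, h'.unitary, Matrix.one_mulVec]
  rfl

end IsUnitaryMatrixOf

/-- The unitary maps are determined by the subspaces, and conjugation by the coordinates turns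
`(U')⁻¹ U` into `V'ᴴ V`. The index thus depends only on the spectrum of this matrix. -/
theorem isMaslovIndex_iff {a b : ℝ} (hab : a ≤ b)
    {Λ Λ' : ℝ → Submodule ℂ (EuclideanSpace ℂ ((ι ⊕ ι) ⊕ (ι ⊕ ι)))}
    {V V' : ℝ → Matrix (ι ⊕ ι) (ι ⊕ ι) ℂ}
    (h : ∀ t ∈ Set.Icc a b, IsUnitaryMatrixOf (Λ t) (V t))
    (h' : ∀ t ∈ Set.Icc a b, IsUnitaryMatrixOf (Λ' t) (V' t)) (m : ℤ) :
    IsMaslovIndex (doubleJ ι) a b Λ Λ' m ↔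
      IsMultisetFlow a b (fun t => ((V' t)ᴴ * V t).charpoly.roots) (-m) := by
  constructor
  · rintro ⟨U, U', hU, hm⟩
    refine (isSpectralFlow_iff (fun t ht => ?_) _).1 hm
    rw [(h t ht).charpoly_eq (h' t ht) (hU t ht).1 (hU t ht).2]
  · intro hm
    have hex : ∀ (W : ℝ → Submodule ℂ (EuclideanSpace ℂ ((ι ⊕ ι) ⊕ (ι ⊕ ι))))
        (M : ℝ → Matrix (ι ⊕ ι) (ι ⊕ ι) ℂ), (∀ t ∈ Set.Icc a b, IsUnitaryMatrixOf (W t) (M t)) →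
        ∃ U : ℝ → UnitaryMaps (doubleJ ι), ∀ t ∈ Set.Icc a b, IsGraphOf (doubleJ ι) (W t) (U t) := by
      intro W M hM
      -- An arbitrary value for the parameters outside `[a, b]`, where nothing is required.
      obtain ⟨U₀, -⟩ := (hM a (Set.left_mem_Icc.2 hab)).exists_isGraphOf
      have : ∀ t, ∃ U : UnitaryMaps (doubleJ ι), t ∈ Set.Icc a b →
          IsGraphOf (doubleJ ι) (W t) U := by
        intro t
        by_cases ht : t ∈ Set.Icc a b
        · exact (hM t ht).exists_isGraphOf.imp fun U hU _ => hU
        · exact ⟨U₀, fun h => absurd h ht⟩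
      choose U hU using this
      exact ⟨U, hU⟩
    obtain ⟨U, hU⟩ := hex Λ V h
    obtain ⟨U', hU'⟩ := hex Λ' V' h'
    refine ⟨U, U', fun t ht => ⟨hU t ht, hU' t ht⟩, (isSpectralFlow_iff (fun t ht => ?_) _).2 hm⟩
    rw [(h t ht).charpoly_eq (h' t ht) (hU t ht) (hU' t ht)]

end UnitaryMaps


/-! ### The boundary conditions -/

section Boundary

variable {ι : Type*}

theorem eq_pair (w : EuclideanSpace ℂ (ι ⊕ ι)) : w = pair (fstC w) (sndC w) := by
  ext (i | i) <;> rfl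

variable [Fintype ι]

/-- The isomorphism `(x, y, z, u) ↦ ((x, -z), (y, u))`. -/
noncomputable def splitEquiv (ι : Type*) [Fintype ι] :
    EuclideanSpace ℂ ((ι ⊕ ι) ⊕ (ι ⊕ ι)) ≃ₗ[ℂ]
      EuclideanSpace ℂ (ι ⊕ ι) × EuclideanSpace ℂ (ι ⊕ ι) where
  toFun w := (pair (fun i => w (Sum.inl (Sum.inl i))) (fun i => -w (Sum.inr (Sum.inl i))),
    pair (fun i => w (Sum.inl (Sum.inr i))) (fun i => w (Sum.inr (Sum.inr i))))
  map_add' x y := by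
    refine Prod.ext ?_ ?_ <;> ext (i | i) <;> simp [pair, add_comm]
  map_smul' c x := by
    refine Prod.ext ?_ ?_ <;> ext (i | i) <;> simp [pair]
  invFun z := WithLp.toLp 2 (Sum.elim
    (Sum.elim (fun i => z.1 (Sum.inl i)) (fun i => z.2 (Sum.inl i)))
    (Sum.elim (fun i => -z.1 (Sum.inr i)) (fun i => z.2 (Sum.inr i))))
  left_inv w := by ext ((i | i) | (i | i)) <;> simp [pair]
  right_inv z := by
    refine Prod.ext ?_ ?_ <;> ext (i | i) <;> simp [pair]

theorem boundaryW_eq_comap (R : Submodule ℂ (EuclideanSpace ℂ (ι ⊕ ι))) :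
    boundaryW R = (Rᗮ.prod R).comap (splitEquiv ι).toLinearMap := rfl

theorem inner_pair (x y z u : ι → ℂ) :
    inner ℂ (pair x y) (pair z u) = star x ⬝ᵥ z + star y ⬝ᵥ u := by
  rw [EuclideanSpace.inner_eq_star_dotProduct, dotProduct_comm]
  simp [pair, dotProduct, Fintype.sum_sum_type]

theorem finrank_comap_prod {V W E : Type*} [AddCommGroup V] [Module ℂ V] [AddCommGroup W]
    [Module ℂ W] [AddCommGroup E] [Module ℂ E] [FiniteDimensional ℂ V] [FiniteDimensional ℂ W]
    (e : E ≃ₗ[ℂ] V × W) (p : Submodule ℂ V) (q : Submodule ℂ W) :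
    Module.finrank ℂ ((p.prod q).comap e.toLinearMap) =
      Module.finrank ℂ p + Module.finrank ℂ q := by
  let f : ↥(p.prod q) ≃ₗ[ℂ] p × q :=
    { toFun := fun x => (⟨x.1.1, x.2.1⟩, ⟨x.1.2, x.2.2⟩)
      map_add' := fun _ _ => rfl
      map_smul' := fun _ _ => rfl
      invFun := fun x => ⟨(x.1.1, x.2.1), x.1.2, x.2.2⟩
      left_inv := fun _ => rfl
      right_inv := fun _ => rfl }
  rw [Submodule.comap_equiv_eq_map_symm, LinearEquiv.finrank_map_eq, f.finrank_eq,
    Module.finrank_prod]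

theorem finrank_boundaryW (R : Submodule ℂ (EuclideanSpace ℂ (ι ⊕ ι))) :
    Module.finrank ℂ (boundaryW R) = Fintype.card (ι ⊕ ι) := by
  rw [boundaryW_eq_comap, finrank_comap_prod, add_comm, R.finrank_add_finrank_orthogonal,
    finrank_euclideanSpace]

/-- The intersection splits as `(Rᗮ ⊓ Sᗮ) × (R ⊓ S)`, and `Rᗮ ⊓ Sᗮ = (R ⊔ S)ᗮ`. -/
theorem finrank_boundaryW_inf (R S : Submodule ℂ (EuclideanSpace ℂ (ι ⊕ ι))) :
    Module.finrank ℂ ↥(boundaryW R ⊓ boundaryW S) + Module.finrank ℂ R + Module.finrank ℂ S =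
      2 * Module.finrank ℂ ↥(R ⊓ S) + Fintype.card (ι ⊕ ι) := by
  have h : boundaryW R ⊓ boundaryW S =
      ((Rᗮ ⊓ Sᗮ).prod (R ⊓ S)).comap (splitEquiv ι).toLinearMap := by
    rw [boundaryW_eq_comap, boundaryW_eq_comap, ← Submodule.comap_inf, Submodule.prod_inf_prod]
  rw [h, finrank_comap_prod, Submodule.inf_orthogonal]
  have h1 := Submodule.finrank_sup_add_finrank_inf_eq R S
  have h2 := (R ⊔ S).finrank_add_finrank_orthogonal
  rw [finrank_euclideanSpace] at h2
  omega

variable [DecidableEq ι]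

theorem mem_graph_one (x y : ι → ℂ) : pair x y ∈ graph (1 : Matrix ι ι ℂ) ↔ x = y := by
  change (y = (1 : Matrix ι ι ℂ) *ᵥ x) ↔ _
  rw [Matrix.one_mulVec, eq_comm]

theorem mem_graph_one_orthogonal (x y : ι → ℂ) :
    pair x y ∈ (graph (1 : Matrix ι ι ℂ))ᗮ ↔ x = -y := by
  rw [Submodule.mem_orthogonal]
  constructor
  · intro h
    have h1 := h (pair (x + y) (x + y)) ((mem_graph_one _ _).2 rfl)
    rw [inner_pair, ← dotProduct_add] at h1
    exact eq_neg_of_add_eq_zero_left (star_dotProduct_self_eq_zero h1)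
  · rintro rfl w hw
    rw [eq_pair w] at hw ⊢
    rw [inner_pair, (mem_graph_one _ _).1 hw, dotProduct_neg, neg_add_cancel]

/-- The orthogonal complement of the diagonal is the antidiagonal, which the sign in `(x, -z)` turns
back into `x = z`. -/
theorem graph_one_eq_boundaryW :
    graph (1 : Matrix (ι ⊕ ι) (ι ⊕ ι) ℂ) = boundaryW (graph (1 : Matrix ι ι ℂ)) := by
  ext w
  change (sndC w = (1 : Matrix (ι ⊕ ι) (ι ⊕ ι) ℂ) *ᵥ fstC w) ↔
    pair _ _ ∈ (graph (1 : Matrix ι ι ℂ))ᗮ ∧ pair _ _ ∈ graph (1 : Matrix ι ι ℂ)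
  rw [Matrix.one_mulVec, mem_graph_one, mem_graph_one_orthogonal]
  constructor
  · intro h
    refine ⟨funext fun i => ?_, funext fun i => ?_⟩
    · exact (congrFun h (Sum.inl i)).symm.trans (neg_neg _).symm
    · exact (congrFun h (Sum.inr i)).symm
  · rintro ⟨h1, h2⟩
    funext i
    rcases i with i | i
    · exact ((congrFun h1 i).trans (neg_neg _)).symm
    · exact (congrFun h2 i).symm

/-- The form is a difference of two pairings of an element of `Rᗮ` with an element of `R`. -/
theorem boundaryW_isotropic (R : Submodule ℂ (EuclideanSpace ℂ (ι ⊕ ι)))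
    {w w' : EuclideanSpace ℂ ((ι ⊕ ι) ⊕ (ι ⊕ ι))} (hw : w ∈ boundaryW R) (hw' : w' ∈ boundaryW R) :
    star w.ofLp ⬝ᵥ (doubleJMatrix ι *ᵥ w'.ofLp) = 0 := by
  have h1 := Submodule.inner_left_of_mem_orthogonal hw'.2 hw.1
  have h2 := Submodule.inner_right_of_mem_orthogonal hw.2 hw'.1
  rw [inner_pair] at h1 h2
  rw [doubleJMatrix, Matrix.J, Matrix.fromBlocks_neg, Matrix.fromBlocks_mulVec,
    Matrix.fromBlocks_mulVec, Matrix.fromBlocks_mulVec]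
  simp only [dotProduct, Fintype.sum_sum_type, Pi.star_apply, Sum.elim_inl, Sum.elim_inr,
    Matrix.neg_mulVec, Matrix.one_mulVec, Matrix.zero_mulVec, neg_zero, zero_add, add_zero, neg_neg,
    Pi.neg_apply, Function.comp_apply, star_neg, neg_mul, mul_neg, Finset.sum_neg_distrib] at h1 h2 ⊢
  linear_combination h1 - h2

/-- The flip fixes the part `(x, -z)` and negates the part `(y, u)`. -/
theorem flip_mem_boundaryW (R : Submodule ℂ (EuclideanSpace ℂ (ι ⊕ ι)))
    {w : EuclideanSpace ℂ ((ι ⊕ ι) ⊕ (ι ⊕ ι))} (hw : w ∈ boundaryW R) :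
    WithLp.toLp 2 (flipMatrix ι *ᵥ w.ofLp) ∈ boundaryW R := by
  refine ⟨?_, ?_⟩
  · convert hw.1 using 1
    ext (i | i) <;> simp [pair, flipMatrix, Matrix.fromBlocks_mulVec]
  · convert R.neg_mem hw.2 using 1
    ext (i | i) <;> simp [pair, flipMatrix, Matrix.fromBlocks_mulVec, Matrix.neg_mulVec]

theorem isotropic_of_forall {Λ : Submodule ℂ (EuclideanSpace ℂ ((ι ⊕ ι) ⊕ (ι ⊕ ι)))}
    {Z : Matrix ((ι ⊕ ι) ⊕ (ι ⊕ ι)) (ι ⊕ ι) ℂ} (hZ : ∀ v, WithLp.toLp 2 (Z *ᵥ v) ∈ Λ)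
    (h : ∀ w ∈ Λ, ∀ w' ∈ Λ, star w.ofLp ⬝ᵥ (doubleJMatrix ι *ᵥ w'.ofLp) = 0) :
    Zᴴ * doubleJMatrix ι * Z = 0 := by
  suffices key : ∀ f, (Zᴴ * doubleJMatrix ι * Z) *ᵥ f = (0 : Matrix _ _ ℂ) *ᵥ f from
    Matrix.ext_of_mulVec_single fun i => key _
  intro f
  rw [Matrix.zero_mulVec]
  refine star_dotProduct_self_eq_zero ?_
  have h1 := h _ (hZ ((Zᴴ * doubleJMatrix ι * Z) *ᵥ f)) _ (hZ f)
  have h2 : star (Z *ᵥ ((Zᴴ * doubleJMatrix ι * Z) *ᵥ f)) ⬝ᵥ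
      (doubleJMatrix ι *ᵥ (Z *ᵥ f)) = 0 := h1
  rw [Matrix.mulVec_mulVec f (doubleJMatrix ι) Z, star_dotProduct_mulVec_mulVec, ← Matrix.mul_assoc] at h2
  exact h2

theorem exists_isLagrangianFrame_boundaryW (R : Submodule ℂ (EuclideanSpace ℂ (ι ⊕ ι))) :
    ∃ Z, IsLagrangianFrame (boundaryW R) Z := by
  let e : (ι ⊕ ι → ℂ) ≃ₗ[ℂ] boundaryW R := LinearEquiv.ofFinrankEq _ _ (by
    rw [finrank_boundaryW, Module.finrank_fintype_fun_eq_card])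
  let Z := LinearMap.toMatrix' ((WithLp.linearEquiv 2 ℂ ((ι ⊕ ι) ⊕ (ι ⊕ ι) → ℂ)).toLinearMap ∘ₗ
    (boundaryW R).subtype ∘ₗ e.toLinearMap)
  have hZ : ∀ v, Z *ᵥ v = (e v : EuclideanSpace ℂ ((ι ⊕ ι) ⊕ (ι ⊕ ι))).ofLp := fun v =>
    LinearMap.toMatrix'_mulVec _ _
  refine ⟨Z, fun w => ⟨fun hw => ⟨e.symm ⟨w, hw⟩, ?_⟩, ?_⟩, ?_, fun v hv => ?_⟩
  · rw [hZ, LinearEquiv.apply_symm_apply]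
  · rintro ⟨v, hv⟩
    rw [hZ] at hv
    have : w = e v := PiLp.ext fun i => congrFun hv i
    rw [this]; exact (e v).2
  · refine isotropic_of_forall (Λ := boundaryW R) (fun v => ?_) fun w hw w' hw' =>
      boundaryW_isotropic R hw hw'
    rw [hZ]; exact (e v).2
  · rw [hZ] at hv
    have : (e v : EuclideanSpace ℂ ((ι ⊕ ι) ⊕ (ι ⊕ ι))) = 0 := PiLp.ext fun i => congrFun hv i
    exact (LinearEquiv.map_eq_zero_iff e).1 (Subtype.ext this)

theorem isLagrangianFrame_graph {γ : Matrix (ι ⊕ ι) (ι ⊕ ι) ℂ}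
    (h : γᴴ * Matrix.J ι ℂ * γ = Matrix.J ι ℂ) :
    IsLagrangianFrame (graph γ) (Matrix.fromRows 1 γ) where
  mem_iff w := by
    change sndC w = γ *ᵥ fstC w ↔ _
    constructor
    · intro hw
      refine ⟨fstC w, ?_⟩
      rw [Matrix.fromRows_mulVec, Matrix.one_mulVec, ← hw]
      funext i
      rcases i with i | i <;> rfl
    · rintro ⟨v, hv⟩
      rw [Matrix.fromRows_mulVec, Matrix.one_mulVec] at hv
      have h1 : fstC w = v := funext fun i => congrFun hv (Sum.inl i)
      have h2 : sndC w = γ *ᵥ v := funext fun i => congrFun hv (Sum.inr i)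
      rw [h1, h2]
  isotropic := by
    rw [Matrix.conjTranspose_fromRows_eq_fromCols_conjTranspose, doubleJMatrix,
      Matrix.fromCols_mul_fromBlocks, Matrix.fromCols_mul_fromRows]
    simp [h]
  eq_zero v hv := by
    rw [Matrix.fromRows_mulVec, Matrix.one_mulVec] at hv
    exact funext fun i => congrFun hv (Sum.inl i)

end Boundary

/-! ### The action of linear isomorphisms -/

section Transform

variable {ι : Type*} [Fintype ι] [DecidableEq ι]

/-- Isotropy is assumed for the target `Λ'`, so `Θ` itself need not be symplectic. -/
theorem IsLagrangianFrame.transform {Λ Λ' : Submodule ℂ (EuclideanSpace ℂ ((ι ⊕ ι) ⊕ (ι ⊕ ι)))}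
    {Z : Matrix ((ι ⊕ ι) ⊕ (ι ⊕ ι)) (ι ⊕ ι) ℂ} (h : IsLagrangianFrame Λ Z)
    {Θ : Matrix ((ι ⊕ ι) ⊕ (ι ⊕ ι)) ((ι ⊕ ι) ⊕ (ι ⊕ ι)) ℂ} (hΘ : IsUnit Θ)
    (hΛ : ∀ w : EuclideanSpace ℂ ((ι ⊕ ι) ⊕ (ι ⊕ ι)), WithLp.toLp 2 (Θ *ᵥ w.ofLp) ∈ Λ' ↔ w ∈ Λ)
    (hiso : ∀ w ∈ Λ', ∀ w' ∈ Λ', star w.ofLp ⬝ᵥ (doubleJMatrix ι *ᵥ w'.ofLp) = 0) :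
    IsLagrangianFrame Λ' (Θ * Z) := by
  have hinj := Matrix.mulVec_injective_iff_isUnit.2 hΘ
  have hmem : ∀ v, WithLp.toLp 2 ((Θ * Z) *ᵥ v) ∈ Λ' := fun v => by
    have := (hΛ (WithLp.toLp 2 (Z *ᵥ v))).2 ((h.mem_iff _).2 ⟨v, rfl⟩)
    rwa [Matrix.mulVec_mulVec] at this
  refine ⟨fun w => ⟨fun hw => ?_, ?_⟩, isotropic_of_forall hmem hiso, fun v hv => ?_⟩
  · obtain ⟨x, hx⟩ := (Matrix.mulVec_surjective_iff_isUnit.2 hΘ) w.ofLp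
    have h1 : WithLp.toLp 2 (Θ *ᵥ (WithLp.toLp 2 x : EuclideanSpace ℂ _).ofLp) ∈ Λ' := by
      rw [hx]; exact hw
    obtain ⟨v, hv⟩ := (h.mem_iff _).1 ((hΛ _).1 h1)
    refine ⟨v, ?_⟩
    rw [← hx, ← Matrix.mulVec_mulVec, ← hv]
  · rintro ⟨v, hv⟩
    have := hmem v
    rwa [← hv] at this
  · rw [← Matrix.mulVec_mulVec] at hv
    exact h.eq_zero v (hinj (hv.trans (Matrix.mulVec_zero _).symm))

theorem finrank_inf_eq_of_transform {κ : Type*} [Fintype κ] [DecidableEq κ]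
    {Λ Λ' M M' : Submodule ℂ (EuclideanSpace ℂ κ)} {Θ : Matrix κ κ ℂ} (hΘ : IsUnit Θ)
    (hΛ : ∀ w : EuclideanSpace ℂ κ, WithLp.toLp 2 (Θ *ᵥ w.ofLp) ∈ Λ' ↔ w ∈ Λ)
    (hM : ∀ w : EuclideanSpace ℂ κ, WithLp.toLp 2 (Θ *ᵥ w.ofLp) ∈ M' ↔ w ∈ M) :
    Module.finrank ℂ ↥(Λ' ⊓ M') = Module.finrank ℂ ↥(Λ ⊓ M) := by
  have hinj : Function.Injective (Matrix.toEuclideanLin Θ) := fun x y hxy =>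
    PiLp.ext fun i => congrFun (Matrix.mulVec_injective_iff_isUnit.2 hΘ (congrArg WithLp.ofLp hxy)) i
  let e := LinearEquiv.ofInjectiveEndo (Matrix.toEuclideanLin Θ) hinj
  have h : Λ ⊓ M = (Λ' ⊓ M').comap e.toLinearMap := by
    ext w
    exact (and_congr (hΛ w) (hM w)).symm
  rw [h, Submodule.comap_equiv_eq_map_symm, LinearEquiv.finrank_map_eq]

/-- The symplectic change of variables `(y, x) ↦ (a^* y, a⁻¹ x)`. -/
noncomputable def liftFrame (a : Matrix ι ι ℂ) : Matrix (ι ⊕ ι) (ι ⊕ ι) ℂ :=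
  Matrix.fromBlocks aᴴ 0 0 a⁻¹

theorem isUnit_fromBlocks_diagonal {m n : Type*} [Fintype m] [Fintype n] [DecidableEq m]
    [DecidableEq n] {A : Matrix m m ℂ} {B : Matrix n n ℂ} (hA : IsUnit A) (hB : IsUnit B) :
    IsUnit (Matrix.fromBlocks A 0 0 B) := by
  rw [Matrix.isUnit_iff_isUnit_det] at hA hB ⊢
  rw [Matrix.det_fromBlocks_zero₂₁]
  exact hA.mul hB

theorem isUnit_liftFrame {a : Matrix ι ι ℂ} (ha : IsUnit a) : IsUnit (liftFrame a) :=
  isUnit_fromBlocks_diagonal ha.star (Matrix.isUnit_nonsing_inv_iff.2 ha)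

theorem liftFrame_one : liftFrame (1 : Matrix ι ι ℂ) = 1 := by
  simp [liftFrame]

theorem liftFrame_symplectic {a : Matrix ι ι ℂ} (ha : IsUnit a) :
    (liftFrame a)ᴴ * Matrix.J ι ℂ * liftFrame a = Matrix.J ι ℂ := by
  have hdet := (Matrix.isUnit_iff_isUnit_det _).1 ha
  rw [liftFrame, Matrix.fromBlocks_conjTranspose, Matrix.J, Matrix.fromBlocks_multiply,
    Matrix.fromBlocks_multiply]
  simp [Matrix.mul_nonsing_inv _ hdet, ← Matrix.conjTranspose_mul]

theorem mulVec_mem_graph_iff {A B : Matrix ι ι ℂ} (hA : IsUnit A) (hB : IsUnit B)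
    (γ : Matrix ι ι ℂ) (w : EuclideanSpace ℂ (ι ⊕ ι)) :
    WithLp.toLp 2 (Matrix.fromBlocks A 0 0 B *ᵥ w.ofLp) ∈ graph (B * γ * A⁻¹) ↔ w ∈ graph γ := by
  have hdet := (Matrix.isUnit_iff_isUnit_det _).1 hA
  change (fun i => (Matrix.fromBlocks A 0 0 B *ᵥ w.ofLp) (Sum.inr i)) =
    (B * γ * A⁻¹) *ᵥ (fun i => (Matrix.fromBlocks A 0 0 B *ᵥ w.ofLp) (Sum.inl i)) ↔
      sndC w = γ *ᵥ fstC w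
  rw [Matrix.fromBlocks_mulVec]
  simp only [Sum.elim_inl, Sum.elim_inr, Matrix.zero_mulVec, add_zero, zero_add]
  change B *ᵥ sndC w = (B * γ * A⁻¹) *ᵥ (A *ᵥ fstC w) ↔ _
  rw [Matrix.mulVec_mulVec, Matrix.mul_assoc, Matrix.nonsing_inv_mul _ hdet, Matrix.mul_one,
    ← Matrix.mulVec_mulVec]
  exact (Matrix.mulVec_injective_iff_isUnit.2 hB).eq_iff

theorem toEuclideanLin_diagonal_pair (α β : Matrix ι ι ℂ) (x y : ι → ℂ) :
    Matrix.toEuclideanLin (Matrix.fromBlocks α 0 0 β) (pair x y) = pair (α *ᵥ x) (β *ᵥ y) := by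
  refine PiLp.ext fun i => ?_
  change (Matrix.fromBlocks α 0 0 β *ᵥ (pair x y).ofLp) i = _
  rw [Matrix.fromBlocks_mulVec]
  rcases i with i | i <;> simp [pair]

theorem mem_frameBoundary_iff (α β : Matrix ι ι ℂ) (R : Submodule ℂ (EuclideanSpace ℂ (ι ⊕ ι)))
    (x y : ι → ℂ) : pair x y ∈ frameBoundary α β R ↔ pair (α *ᵥ x) (β *ᵥ y) ∈ R := by
  rw [← toEuclideanLin_diagonal_pair]; rfl

theorem mem_frameBoundary_orthogonal_iff {α β : Matrix ι ι ℂ} (hα : IsUnit α) (hβ : IsUnit β)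
    (R : Submodule ℂ (EuclideanSpace ℂ (ι ⊕ ι))) (x y : ι → ℂ) :
    pair (αᴴ *ᵥ x) (βᴴ *ᵥ y) ∈ (frameBoundary α β R)ᗮ ↔ pair x y ∈ Rᗮ := by
  have key : ∀ (A : Matrix ι ι ℂ) (f g : ι → ℂ), star f ⬝ᵥ (Aᴴ *ᵥ g) = star (A *ᵥ f) ⬝ᵥ g := by
    intro A f g
    have := star_dotProduct_mulVec_mulVec A 1 f g
    rwa [Matrix.one_mulVec, Matrix.mul_one, eq_comm] at this
  rw [Submodule.mem_orthogonal, Submodule.mem_orthogonal]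
  constructor
  · intro h w hw
    obtain ⟨f, hf⟩ := Matrix.mulVec_surjective_iff_isUnit.2 hα (fstC w)
    obtain ⟨g, hg⟩ := Matrix.mulVec_surjective_iff_isUnit.2 hβ (sndC w)
    rw [eq_pair w, ← hf, ← hg] at hw ⊢
    have := h _ ((mem_frameBoundary_iff α β R f g).2 hw)
    rwa [inner_pair, key, key, ← inner_pair] at this
  · intro h w hw
    rw [eq_pair w] at hw ⊢
    rw [inner_pair, key, key, ← inner_pair]
    exact h _ ((mem_frameBoundary_iff α β R _ _).1 hw)

/-- The block `a⁻¹` of `liftFrame` carries `R` to its preimage under the frame, and the block `aᴴ`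
carries `Rᗮ` to the orthogonal complement of that preimage. -/
theorem mulVec_mem_boundaryW_iff {α β : Matrix ι ι ℂ} (hα : IsUnit α) (hβ : IsUnit β)
    (R : Submodule ℂ (EuclideanSpace ℂ (ι ⊕ ι))) (w : EuclideanSpace ℂ ((ι ⊕ ι) ⊕ (ι ⊕ ι))) :
    WithLp.toLp 2 (Matrix.fromBlocks (liftFrame α) 0 0 (liftFrame β) *ᵥ w.ofLp) ∈
      boundaryW (frameBoundary α β R) ↔ w ∈ boundaryW R := by
  have hα' := (Matrix.isUnit_iff_isUnit_det _).1 hα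
  have hβ' := (Matrix.isUnit_iff_isUnit_det _).1 hβ
  have hw : Matrix.fromBlocks (liftFrame α) 0 0 (liftFrame β) *ᵥ w.ofLp = Sum.elim
      (Sum.elim (αᴴ *ᵥ fun i => w (Sum.inl (Sum.inl i))) (α⁻¹ *ᵥ fun i => w (Sum.inl (Sum.inr i))))
      (Sum.elim (βᴴ *ᵥ fun i => w (Sum.inr (Sum.inl i)))
        (β⁻¹ *ᵥ fun i => w (Sum.inr (Sum.inr i)))) := by
    simp only [liftFrame, Matrix.fromBlocks_mulVec, Matrix.zero_mulVec, add_zero, zero_add]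
    rfl
  rw [hw]
  refine and_congr ((iff_of_eq (congrArg (· ∈ _) (congrArg₂ pair rfl ?_))).trans
    (mem_frameBoundary_orthogonal_iff hα hβ R _ _)) ((mem_frameBoundary_iff α β R _ _).trans
    (iff_of_eq (congrArg (· ∈ R) (congrArg₂ pair ?_ ?_))))
  · exact (Matrix.mulVec_neg _ _).symm
  · exact (Matrix.mulVec_mulVec _ _ _).trans (by rw [Matrix.mul_nonsing_inv _ hα', Matrix.one_mulVec])
  · exact (Matrix.mulVec_mulVec _ _ _).trans (by rw [Matrix.mul_nonsing_inv _ hβ', Matrix.one_mulVec])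

theorem finrank_frameBoundary {α β : Matrix ι ι ℂ} (hα : IsUnit α) (hβ : IsUnit β)
    (R : Submodule ℂ (EuclideanSpace ℂ (ι ⊕ ι))) :
    Module.finrank ℂ (frameBoundary α β R) = Module.finrank ℂ R := by
  have := finrank_inf_eq_of_transform (Λ' := R) (M' := R) (Λ := frameBoundary α β R)
    (M := frameBoundary α β R) (isUnit_fromBlocks_diagonal hα hβ) (fun _ => Iff.rfl)
    fun _ => Iff.rfl
  rw [inf_idem, inf_idem] at this
  exact this.symm

end Transform


/-! ### The fundamental solutions in the two frames -/

section Solutions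

/-- Entrywise differentiability of a matrix-valued function within a set. -/
def HasEntryDeriv {m n : Type*} (A : ℝ → Matrix m n ℂ) (A' : Matrix m n ℂ) (s : Set ℝ) (t : ℝ) :
    Prop :=
  ∀ i k, HasDerivWithinAt (fun u => A u i k) (A' i k) s t

namespace HasEntryDeriv

variable {l m n o : Type*} {s : Set ℝ} {t : ℝ}

theorem mul [Fintype m] {A : ℝ → Matrix l m ℂ} {B : ℝ → Matrix m n ℂ} {A' : Matrix l m ℂ}
    {B' : Matrix m n ℂ} (hA : HasEntryDeriv A A' s t) (hB : HasEntryDeriv B B' s t) :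
    HasEntryDeriv (fun u => A u * B u) (A' * B t + A t * B') s t := by
  intro i k
  simp only [Matrix.mul_apply, Matrix.add_apply, ← Finset.sum_add_distrib]
  exact HasDerivWithinAt.fun_sum fun j _ => (hA i j).mul (hB j k)

theorem conjTranspose {A : ℝ → Matrix m n ℂ} {A' : Matrix m n ℂ} (hA : HasEntryDeriv A A' s t) :
    HasEntryDeriv (fun u => (A u)ᴴ) A'ᴴ s t := fun i k => (hA k i).star

theorem const (A : Matrix m n ℂ) : HasEntryDeriv (fun _ => A) 0 s t :=
  fun i k => hasDerivWithinAt_const t s (A i k)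

theorem fromBlocks {A : ℝ → Matrix l n ℂ} {B : ℝ → Matrix l o ℂ} {C : ℝ → Matrix m n ℂ}
    {D : ℝ → Matrix m o ℂ} {A' : Matrix l n ℂ} {B' : Matrix l o ℂ} {C' : Matrix m n ℂ}
    {D' : Matrix m o ℂ} (hA : HasEntryDeriv A A' s t) (hB : HasEntryDeriv B B' s t)
    (hC : HasEntryDeriv C C' s t) (hD : HasEntryDeriv D D' s t) :
    HasEntryDeriv (fun u => Matrix.fromBlocks (A u) (B u) (C u) (D u))
      (Matrix.fromBlocks A' B' C' D') s t := by
  rintro (i | i) (k | k)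
  exacts [hA i k, hB i k, hC i k, hD i k]

open scoped Matrix.Norms.Operator in
theorem inv [Fintype m] [DecidableEq m] {A : ℝ → Matrix m m ℂ} {A' : Matrix m m ℂ}
    (hA : HasEntryDeriv A A' s t) (hu : IsUnit (A t)) :
    HasEntryDeriv (fun u => (A u)⁻¹) (-((A t)⁻¹ * A' * (A t)⁻¹)) s t := by
  have h1 : HasDerivWithinAt A A' s t :=
    hasDerivWithinAt_pi.2 fun i => hasDerivWithinAt_pi.2 fun k => hA i k
  obtain ⟨x, hx⟩ := hu
  have h2 := hasFDerivAt_ringInverse (𝕜 := ℝ) x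
  rw [hx] at h2
  have h3 := h2.comp_hasDerivWithinAt t h1
  have h4 : (-((A t)⁻¹ * A' * (A t)⁻¹)) =
      (-ContinuousLinearMap.mulLeftRight ℝ (Matrix m m ℂ) ↑x⁻¹ ↑x⁻¹) A' := by
    rw [← hx, ← Matrix.coe_units_inv]
    simp
  rw [h4]
  intro i k
  have h5 := hasDerivWithinAt_pi.1 (hasDerivWithinAt_pi.1 h3 i) k
  simpa only [Function.comp_apply, Matrix.nonsing_inv_eq_ringInverse] using h5

theorem eq_of_zero {T : ℝ} {A : ℝ → Matrix m n ℂ}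
    (h : ∀ t ∈ Set.Icc 0 T, HasEntryDeriv A 0 (Set.Icc 0 T) t) {t : ℝ} (ht : t ∈ Set.Icc 0 T) :
    A t = A 0 := by
  ext i k
  refine constant_of_has_deriv_right_zero (f := fun u => A u i k)
    (fun u hu => (h u hu i k).continuousWithinAt) (fun u hu => ?_) t ht
  exact (h u ⟨hu.1, hu.2.le⟩ i k).mono_of_mem_nhdsWithin (Icc_mem_nhdsGE_of_mem hu)

end HasEntryDeriv

variable {ι : Type*} [DecidableEq ι]

theorem conjTranspose_J : (Matrix.J ι ℂ)ᴴ = -Matrix.J ι ℂ := by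
  simp [Matrix.J, Matrix.fromBlocks_conjTranspose, Matrix.fromBlocks_neg]

variable [Fintype ι] {T : ℝ}

theorem J_mul_J : Matrix.J ι ℂ * Matrix.J ι ℂ = -1 := Matrix.J_squared ι ℂ

/-- The Wronskian of the solutions of two Hamiltonian systems related by the change of variables
`M` is constant. -/
theorem IsFundamentalSolution.wronskian {b₁ b₂ γ₁ γ₂ M M' : ℝ → Matrix (ι ⊕ ι) (ι ⊕ ι) ℂ}
    (h₁ : IsFundamentalSolution T b₁ γ₁) (h₂ : IsFundamentalSolution T b₂ γ₂)
    (hb : ∀ t ∈ Set.Icc 0 T, (b₁ t)ᴴ = b₁ t)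
    (hM : ∀ t ∈ Set.Icc 0 T, HasEntryDeriv M (M' t) (Set.Icc 0 T) t)
    (hc : ∀ t ∈ Set.Icc 0 T, b₁ t * M t + Matrix.J ι ℂ * M' t +
      Matrix.J ι ℂ * M t * Matrix.J ι ℂ * b₂ t = 0) {t : ℝ} (ht : t ∈ Set.Icc 0 T) :
    (γ₁ t)ᴴ * (Matrix.J ι ℂ * M t * γ₂ t) = Matrix.J ι ℂ * M 0 := by
  have h : ∀ t ∈ Set.Icc 0 T, HasEntryDeriv
      (fun t => (γ₁ t)ᴴ * (Matrix.J ι ℂ * M t * γ₂ t)) 0 (Set.Icc 0 T) t := by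
    intro t ht
    have h3 : HasEntryDeriv γ₁ (Matrix.J ι ℂ * b₁ t * γ₁ t) (Set.Icc 0 T) t := h₁.2 t ht
    have h4 : HasEntryDeriv γ₂ (Matrix.J ι ℂ * b₂ t * γ₂ t) (Set.Icc 0 T) t := h₂.2 t ht
    convert h3.conjTranspose.mul (((HasEntryDeriv.const (Matrix.J ι ℂ)).mul (hM t ht)).mul h4)
      using 1
    have h5 : (Matrix.J ι ℂ * b₁ t * γ₁ t)ᴴ * (Matrix.J ι ℂ * M t * γ₂ t) =
        (γ₁ t)ᴴ * (b₁ t * M t * γ₂ t) := by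
      rw [Matrix.conjTranspose_mul, Matrix.conjTranspose_mul, hb t ht, conjTranspose_J]
      have : -(Matrix.J ι ℂ) * (Matrix.J ι ℂ * M t * γ₂ t) = M t * γ₂ t := by
        rw [Matrix.mul_assoc, ← Matrix.mul_assoc, Matrix.neg_mul, J_mul_J, neg_neg, Matrix.one_mul]
      rw [Matrix.mul_assoc, Matrix.mul_assoc, this, Matrix.mul_assoc]
    have h6 := congrArg (fun X => (γ₁ t)ᴴ * (X * γ₂ t)) (hc t ht)
    simp only [Matrix.zero_mul, Matrix.mul_zero] at h6
    rw [h5]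
    refine h6.symm.trans ?_
    simp only [Matrix.zero_mul, zero_add, Matrix.mul_add, Matrix.add_mul, Matrix.mul_assoc]
    abel
  have := HasEntryDeriv.eq_of_zero h ht
  rw [this, h₁.1, h₂.1, Matrix.conjTranspose_one, Matrix.one_mul, Matrix.mul_one]

theorem isHermitian_hamiltonian {p q r : Matrix ι ι ℂ} (hp : p.IsHermitian) (hr : r.IsHermitian) :
    (hamiltonian p q r)ᴴ = hamiltonian p q r := by
  simp [hamiltonian, Matrix.fromBlocks_conjTranspose, Matrix.conjTranspose_nonsing_inv, hp.eq,
    hr.eq, Matrix.mul_assoc]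

/-- The Wronskian of the system with itself, for `M = 1`; the coefficient condition becomes `b + J²
b = 0`. -/
theorem IsFundamentalSolution.symplectic {b γ : ℝ → Matrix (ι ⊕ ι) (ι ⊕ ι) ℂ}
    (h : IsFundamentalSolution T b γ) (hb : ∀ t ∈ Set.Icc 0 T, (b t)ᴴ = b t) {t : ℝ}
    (ht : t ∈ Set.Icc 0 T) : (γ t)ᴴ * Matrix.J ι ℂ * γ t = Matrix.J ι ℂ := by
  have := h.wronskian (M := fun _ => 1) (M' := fun _ => 0) h hb
    (fun t _ => HasEntryDeriv.const 1) (fun t _ => by simp [J_mul_J]) ht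
  simpa [Matrix.mul_assoc] using this

/-- Multiplied by `J`, this reads `M' = J b M - M J b'` for `M = diag((a^*)⁻¹, a)`, the inverse of
`liftFrame a`. It says that `M` takes solutions of the new system to solutions of the old one. -/
theorem frame_identity {p q r a d : Matrix ι ι ℂ} (hp : pᴴ = p) (hp_inv : IsUnit p)
    (ha : IsUnit a) :
    hamiltonian p q r * Matrix.fromBlocks (aᴴ)⁻¹ 0 0 a +
      Matrix.J ι ℂ * Matrix.fromBlocks (-((aᴴ)⁻¹ * dᴴ * (aᴴ)⁻¹)) 0 0 d +
      Matrix.J ι ℂ * Matrix.fromBlocks (aᴴ)⁻¹ 0 0 a * Matrix.J ι ℂ *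
        hamiltonian (frameP p a) (frameQ p q a d) (frameR p q r a d) = 0 := by
  have h1 := (Matrix.isUnit_iff_isUnit_det _).1 hp_inv
  have h2 := (Matrix.isUnit_iff_isUnit_det _).1 ha
  have h3 : IsUnit (aᴴ).det := (Matrix.isUnit_iff_isUnit_det _).1 ha.star
  have e1 : ∀ X : Matrix ι ι ℂ, p⁻¹ * (p * X) = X := fun X =>
    Matrix.nonsing_inv_mul_cancel_left _ X h1
  have e2 : ∀ X : Matrix ι ι ℂ, p * (p⁻¹ * X) = X := fun X =>
    Matrix.mul_nonsing_inv_cancel_left _ X h1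
  have e3 : ∀ X : Matrix ι ι ℂ, a * (a⁻¹ * X) = X := fun X =>
    Matrix.mul_nonsing_inv_cancel_left _ X h2
  have e4 : ∀ X : Matrix ι ι ℂ, (aᴴ)⁻¹ * (aᴴ * X) = X := fun X =>
    Matrix.nonsing_inv_mul_cancel_left _ X h3
  simp only [hamiltonian, frameP, frameQ, frameR, Matrix.J, Matrix.fromBlocks_multiply,
    Matrix.fromBlocks_add, Matrix.mul_inv_rev, Matrix.conjTranspose_add, Matrix.conjTranspose_mul,
    Matrix.conjTranspose_conjTranspose, hp, Matrix.mul_zero, Matrix.zero_mul, zero_add, add_zero,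
    Matrix.mul_one, Matrix.one_mul, Matrix.neg_mul, Matrix.mul_neg, Matrix.mul_add, Matrix.add_mul,
    Matrix.mul_sub, Matrix.sub_mul, Matrix.mul_assoc, e1, e2, e3, e4, neg_add, neg_neg, neg_zero]
  rw [← Matrix.fromBlocks_zero]
  congr 1 <;> abel

/-- The fundamental solution in the frame `a` is the conjugate of the original one. -/
theorem IsFundamentalSolution.eq_liftFrame {p q r a d : ℝ → Matrix ι ι ℂ}
    {γ γ' : ℝ → Matrix (ι ⊕ ι) (ι ⊕ ι) ℂ}
    (hp : ∀ t ∈ Set.Icc 0 T, (p t).IsHermitian) (hr : ∀ t ∈ Set.Icc 0 T, (r t).IsHermitian)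
    (hp_inv : ∀ t ∈ Set.Icc 0 T, IsUnit (p t)) (ha_inv : ∀ t ∈ Set.Icc 0 T, IsUnit (a t))
    (ha : ∀ t ∈ Set.Icc 0 T, HasEntryDeriv a (d t) (Set.Icc 0 T) t)
    (hγ : IsFundamentalSolution T (fun t => hamiltonian (p t) (q t) (r t)) γ)
    (hγ' : IsFundamentalSolution T (fun t => hamiltonian (frameP (p t) (a t))
      (frameQ (p t) (q t) (a t) (d t)) (frameR (p t) (q t) (r t) (a t) (d t))) γ')
    {t : ℝ} (ht : t ∈ Set.Icc 0 T) :
    γ' t = liftFrame (a t) * γ t * (liftFrame (a 0))⁻¹ := by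
  have h0 : (0 : ℝ) ∈ Set.Icc 0 T := ⟨le_rfl, ht.1.trans ht.2⟩
  have hb : ∀ t ∈ Set.Icc 0 T,
      (hamiltonian (p t) (q t) (r t))ᴴ = hamiltonian (p t) (q t) (r t) :=
    fun t ht => isHermitian_hamiltonian (hp t ht) (hr t ht)
  have hs := hγ.symplectic hb ht
  have hw := hγ.wronskian hγ' hb (M := fun t => Matrix.fromBlocks ((a t)ᴴ)⁻¹ 0 0 (a t))
    (fun t ht => ((ha t ht).conjTranspose.inv (ha_inv t ht).star).fromBlocks
      (HasEntryDeriv.const 0) (HasEntryDeriv.const 0) (ha t ht))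
    (fun t ht => frame_identity (hp t ht).eq (hp_inv t ht) (ha_inv t ht)) ht
  have hinv : ∀ t ∈ Set.Icc 0 T, liftFrame (a t) * Matrix.fromBlocks ((a t)ᴴ)⁻¹ 0 0 (a t) = 1 := by
    intro t ht
    have h2 := (Matrix.isUnit_iff_isUnit_det _).1 (ha_inv t ht)
    have h3 : IsUnit ((a t)ᴴ).det := (Matrix.isUnit_iff_isUnit_det _).1 (ha_inv t ht).star
    simp [liftFrame, Matrix.fromBlocks_multiply, Matrix.mul_nonsing_inv _ h3,
      Matrix.nonsing_inv_mul _ h2]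
  -- The inverse of a symplectic matrix is `-J γ^* J`.
  have hleft : (-(Matrix.J ι ℂ * (γ t)ᴴ * Matrix.J ι ℂ)) * γ t = 1 := by
    rw [Matrix.neg_mul, Matrix.mul_assoc, Matrix.mul_assoc, ← Matrix.mul_assoc (γ t)ᴴ, hs, J_mul_J,
      neg_neg]
  have hright := mul_eq_one_comm.1 hleft
  -- The constant Wronskian solved for `γ'`: `M(t) γ'(t) = γ(t) M(0)`.
  have hkey : Matrix.fromBlocks ((a t)ᴴ)⁻¹ 0 0 (a t) * γ' t =
      γ t * Matrix.fromBlocks ((a 0)ᴴ)⁻¹ 0 0 (a 0) := by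
    have h5 := congrArg (fun X => -(γ t * (Matrix.J ι ℂ * X))) hw
    rw [← Matrix.mul_assoc (Matrix.J ι ℂ) (Matrix.J ι ℂ), J_mul_J, Matrix.neg_mul, Matrix.one_mul,
      Matrix.mul_neg, neg_neg] at h5
    rw [← h5]
    have h6 : -(γ t * (Matrix.J ι ℂ * ((γ t)ᴴ * (Matrix.J ι ℂ *
        Matrix.fromBlocks ((a t)ᴴ)⁻¹ 0 0 (a t) * γ' t)))) =
        (γ t * -(Matrix.J ι ℂ * (γ t)ᴴ * Matrix.J ι ℂ)) *
          (Matrix.fromBlocks ((a t)ᴴ)⁻¹ 0 0 (a t) * γ' t) := by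
      simp only [Matrix.mul_assoc, Matrix.mul_neg, Matrix.neg_mul]
    rw [h6, hright, Matrix.one_mul]
  rw [Matrix.inv_eq_right_inv (hinv 0 h0), Matrix.mul_assoc, ← hkey, ← Matrix.mul_assoc, hinv t ht,
    Matrix.one_mul]

end Solutions


/-! ### Homotopies of pairs of Lagrangian subspaces -/

section Homotopy

variable {ι : Type*} [Fintype ι] [DecidableEq ι]

theorem IsUnitaryMatrixOf.isCircleFamily {X : Type*} [TopologicalSpace X]
    {Λ Λ' : X → Submodule ℂ (EuclideanSpace ℂ ((ι ⊕ ι) ⊕ (ι ⊕ ι)))}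
    {V V' : X → Matrix (ι ⊕ ι) (ι ⊕ ι) ℂ} (hV : Continuous V) (hV' : Continuous V')
    (h : ∀ x, IsUnitaryMatrixOf (Λ x) (V x)) (h' : ∀ x, IsUnitaryMatrixOf (Λ' x) (V' x)) :
    IsCircleFamily (Fintype.card (ι ⊕ ι)) (fun x => ((V' x)ᴴ * V x).charpoly.roots) := by
  refine isCircleFamily_charpoly (hV'.matrix_conjTranspose.matrix_mul hV) fun x => ?_
  rw [Matrix.conjTranspose_mul, Matrix.conjTranspose_conjTranspose, Matrix.mul_assoc,
    ← Matrix.mul_assoc (V' x), (h' x).mul_conjTranspose, Matrix.one_mul, (h x).unitary]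

/-- Uniqueness holds because `IsMultisetFlow.eq` expresses the flow without reference to the
subdivision. -/
theorem IsCircleFamily.existsUnique_neg_flow {N : ℕ} {S : ℝ → Multiset ℂ} {φ : ℝ → ℝ}
    (hS : IsCircleFamily N S) (hφ : Continuous φ)
    (hφS : ∀ t, Complex.exp (φ t * Complex.I) = (S t).prod) {a b : ℝ} (hab : a ≤ b) :
    ∃! m : ℤ, IsMultisetFlow a b S (-m) := by
  obtain ⟨m, hm⟩ := hS.exists_flow hab
  refine ⟨-m, by simpa using hm, fun k hk => ?_⟩
  have h1 := hk.eq hS hφ hφS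
  rw [← hm.eq hS hφ hφS] at h1
  have h2 : ((-k : ℤ) : ℝ) = m := mul_left_cancel₀ Real.two_pi_pos.ne' h1
  have h3 : -k = m := by exact_mod_cast h2
  omega

/-- The change of the Maslov index under a homotopy of pairs of Lagrangian subspaces that keeps the
dimension of the intersection at the end `t = T`, and for which the subspaces at `t = 0` are
invariant under the anti-symplectic flip. -/
theorem maslovIndex_homotopy {T : ℝ} (hT : 0 < T)
    {Λ : ℝ × ℝ → Submodule ℂ (EuclideanSpace ℂ ((ι ⊕ ι) ⊕ (ι ⊕ ι)))}
    {Λ' : ℝ → Submodule ℂ (EuclideanSpace ℂ ((ι ⊕ ι) ⊕ (ι ⊕ ι)))}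
    {Z : ℝ × ℝ → Matrix ((ι ⊕ ι) ⊕ (ι ⊕ ι)) (ι ⊕ ι) ℂ}
    {Z' : ℝ → Matrix ((ι ⊕ ι) ⊕ (ι ⊕ ι)) (ι ⊕ ι) ℂ} (hZ : Continuous Z) (hZ' : Continuous Z')
    (hΛ : ∀ x, IsLagrangianFrame (Λ x) (Z x)) (hΛ' : ∀ s, IsLagrangianFrame (Λ' s) (Z' s))
    (hend : ∀ s, Module.finrank ℂ ↥(Λ (s, T) ⊓ Λ' s) = Module.finrank ℂ ↥(Λ (0, T) ⊓ Λ' 0))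
    (hflip : ∀ s, ∀ w ∈ Λ (s, 0), WithLp.toLp 2 (flipMatrix ι *ᵥ w.ofLp) ∈ Λ (s, 0))
    (hflip' : ∀ s, ∀ w ∈ Λ' s, WithLp.toLp 2 (flipMatrix ι *ᵥ w.ofLp) ∈ Λ' s)
    {Λ₀ Λ₁ : ℝ → Submodule ℂ (EuclideanSpace ℂ ((ι ⊕ ι) ⊕ (ι ⊕ ι)))}
    (hΛ₀ : ∀ t ∈ Set.Icc 0 T, Λ₀ t = Λ (0, t)) (hΛ₁ : ∀ t ∈ Set.Icc 0 T, Λ₁ t = Λ (1, t)) :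
    (∃! m : ℤ, IsMaslovIndex (doubleJ ι) 0 T Λ₀ (fun _ => Λ' 0) m) ∧
    (∃! m : ℤ, IsMaslovIndex (doubleJ ι) 0 T Λ₁ (fun _ => Λ' 1) m) ∧
    ∀ m m' : ℤ, IsMaslovIndex (doubleJ ι) 0 T Λ₀ (fun _ => Λ' 0) m →
      IsMaslovIndex (doubleJ ι) 0 T Λ₁ (fun _ => Λ' 1) m' →
      2 * (m' - m) = (Module.finrank ℂ ↥(Λ (1, 0) ⊓ Λ' 1) : ℤ) -
        (Module.finrank ℂ ↥(Λ (0, 0) ⊓ Λ' 0) : ℤ) := by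
  have hU := fun x => (hΛ x).isUnitaryMatrixOf
  have hU' := fun s => (hΛ' s).isUnitaryMatrixOf
  let S : ℝ × ℝ → Multiset ℂ := fun x =>
    ((frameUnitary (Z' x.1))ᴴ * frameUnitary (Z x)).charpoly.roots
  have hS : IsCircleFamily (Fintype.card (ι ⊕ ι)) S :=
    IsUnitaryMatrixOf.isCircleFamily (V' := fun x : ℝ × ℝ => frameUnitary (Z' x.1))
      (continuous_frameUnitary hZ hΛ) ((continuous_frameUnitary hZ' hΛ').comp continuous_fst)
      hU (fun x => hU' x.1)
  -- A single lift over the whole parameter plane, so that its increments along the four sides of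
  -- the rectangle cancel.
  obtain ⟨φ, hφ, hφS⟩ := hS.exists_lift
  have hcount : ∀ x : ℝ × ℝ, (S x).count 1 = Module.finrank ℂ ↥(Λ x ⊓ Λ' x.1) := fun x =>
    ((hU x).finrank_inf (hU' x.1)).symm
  have hrow : ∀ s : ℝ, Continuous fun t : ℝ => (s, t) := fun s => by fun_prop
  have hcol : ∀ t : ℝ, Continuous fun s : ℝ => (s, t) := fun t => by fun_prop
  have hiff₀ : ∀ m, IsMaslovIndex (doubleJ ι) 0 T Λ₀ (fun _ => Λ' 0) m ↔
      IsMultisetFlow 0 T (fun t => S (0, t)) (-m) :=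
    isMaslovIndex_iff hT.le (fun t ht => by rw [hΛ₀ t ht]; exact hU _) (fun _ _ => hU' 0)
  have hiff₁ : ∀ m, IsMaslovIndex (doubleJ ι) 0 T Λ₁ (fun _ => Λ' 1) m ↔
      IsMultisetFlow 0 T (fun t => S (1, t)) (-m) :=
    isMaslovIndex_iff hT.le (fun t ht => by rw [hΛ₁ t ht]; exact hU _) (fun _ _ => hU' 1)
  simp only [hiff₀, hiff₁]
  refine ⟨(hS.comp (hrow 0)).existsUnique_neg_flow (hφ.comp (hrow 0)) (fun t => hφS _) hT.le,
    (hS.comp (hrow 1)).existsUnique_neg_flow (hφ.comp (hrow 1)) (fun t => hφS _) hT.le,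
    fun m m' hm hm' => ?_⟩
  have h0 := hm.eq (hS.comp (hrow 0)) (hφ.comp (hrow 0)) (fun t => hφS _)
  have h1 := hm'.eq (hS.comp (hrow 1)) (hφ.comp (hrow 1)) (fun t => hφS _)
  have h2 := (hS.comp (hcol T)).sub_angleSum_eq_of_count (hφ.comp (hcol T)) (fun t => hφS _)
    zero_le_one (fun s _ => by rw [hcount, hcount]; exact hend s)
  -- At `t = 0` both unitary matrices are involutions, hence Hermitian, so conjugating `V' V` by `V`
  -- gives `V V' = (V' V)^*` and the spectrum is symmetric.
  have h3 := (hS.comp (hcol 0)).two_mul_sub_angleSum_of_conj (hφ.comp (hcol 0)) (fun t => hφS _)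
    zero_le_one (fun s _ => by
      have e1 := (hU (s, 0)).mul_self_of_flip (hflip s)
      have e2 := (hU' s).mul_self_of_flip (hflip' s)
      have e3 : (frameUnitary (Z (s, 0)))ᴴ = frameUnitary (Z (s, 0)) :=
        left_inv_eq_right_inv (hU (s, 0)).unitary e1
      refine map_conj_roots_charpoly e1 ?_
      rw [Matrix.conjTranspose_mul, Matrix.conjTranspose_conjTranspose, e3,
        left_inv_eq_right_inv (hU' s).unitary e2, Matrix.mul_assoc, Matrix.mul_assoc, e1,
        Matrix.mul_one])
  simp only [Function.comp_apply, hcount] at h0 h1 h2 h3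
  have h4 : Real.pi * (2 * (m' - m) : ℝ) =
      Real.pi * ((Module.finrank ℂ ↥(Λ (1, 0) ⊓ Λ' 1) : ℝ) -
        (Module.finrank ℂ ↥(Λ (0, 0) ⊓ Λ' 0) : ℝ)) := by
    push_cast at h0 h1
    linarith
  exact_mod_cast mul_left_cancel₀ Real.pi_ne_zero h4

/-- The polynomial `det (1 + z (A - 1))` is nonzero at `0` and `1`. Its finitely many zeros do not
disconnect `ℂ`, so a path from `0` to `1` avoids them. -/
theorem exists_path_isUnit {κ : Type*} [Fintype κ] [DecidableEq κ] {A : Matrix κ κ ℂ}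
    (hA : IsUnit A) :
    ∃ g : ℝ → Matrix κ κ ℂ, Continuous g ∧ (∀ s, IsUnit (g s)) ∧ g 0 = 1 ∧ g 1 = A := by
  let P : Polynomial ℂ := (1 + (Polynomial.X : Polynomial ℂ) • (A - 1).map Polynomial.C).det
  have hP : ∀ z : ℂ, P.eval z = (1 + z • (A - 1)).det := by
    intro z
    rw [← Polynomial.coe_evalRingHom, RingHom.map_det]
    congr 1
    ext i j
    by_cases hij : i = j
    · simp [hij]
    · simp [hij, mul_comm z]
  have hP0 : P ≠ 0 := by
    intro h
    have := hP 0
    simp [h] at this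
  have hfin : {z : ℂ | P.eval z = 0}.Finite := by
    refine P.roots.toFinset.finite_toSet.subset fun z hz => ?_
    simpa [hP0] using hz
  have hconn := hfin.countable.isPathConnected_compl_of_one_lt_rank (E := ℂ) (by
    rw [Complex.rank_real_complex]; exact Cardinal.one_lt_two)
  have hunit : ∀ z ∈ {z : ℂ | P.eval z = 0}ᶜ, IsUnit (1 + z • (A - 1)) := by
    intro z hz
    rw [Matrix.isUnit_iff_isUnit_det, ← hP]
    exact isUnit_iff_ne_zero.2 hz
  have hj := hconn.joinedIn 0 (by simp [hP]) 1 (by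
    have := ((Matrix.isUnit_iff_isUnit_det _).1 hA).ne_zero
    simpa [hP] using this)
  refine ⟨fun s => 1 + hj.somePath (Set.projIcc 0 1 zero_le_one s) • (A - 1), ?_, fun s => ?_, ?_,
    ?_⟩
  · exact continuous_const.add
      ((hj.somePath.continuous.comp continuous_projIcc).smul continuous_const)
  · exact hunit _ (hj.somePath_mem _)
  · simp
  · simp

theorem symplectic_mul {M N : Matrix (ι ⊕ ι) (ι ⊕ ι) ℂ}
    (hM : Mᴴ * Matrix.J ι ℂ * M = Matrix.J ι ℂ) (hN : Nᴴ * Matrix.J ι ℂ * N = Matrix.J ι ℂ) :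
    (M * N)ᴴ * Matrix.J ι ℂ * (M * N) = Matrix.J ι ℂ := by
  rw [Matrix.conjTranspose_mul]
  calc Nᴴ * Mᴴ * Matrix.J ι ℂ * (M * N) = Nᴴ * (Mᴴ * Matrix.J ι ℂ * M) * N := by
        simp only [Matrix.mul_assoc]
    _ = Matrix.J ι ℂ := by rw [hM, hN]

theorem symplectic_inv {M : Matrix (ι ⊕ ι) (ι ⊕ ι) ℂ} (hu : IsUnit M)
    (hM : Mᴴ * Matrix.J ι ℂ * M = Matrix.J ι ℂ) :
    (M⁻¹)ᴴ * Matrix.J ι ℂ * M⁻¹ = Matrix.J ι ℂ := by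
  have hdet := (Matrix.isUnit_iff_isUnit_det _).1 hu
  have h1 : (M⁻¹)ᴴ * Mᴴ = 1 := by
    rw [← Matrix.conjTranspose_mul, Matrix.mul_nonsing_inv _ hdet, Matrix.conjTranspose_one]
  calc (M⁻¹)ᴴ * Matrix.J ι ℂ * M⁻¹ = (M⁻¹)ᴴ * (Mᴴ * Matrix.J ι ℂ * M) * M⁻¹ := by rw [hM]
    _ = ((M⁻¹)ᴴ * Mᴴ) * Matrix.J ι ℂ * (M * M⁻¹) := by simp only [Matrix.mul_assoc]
    _ = Matrix.J ι ℂ := by rw [h1, Matrix.mul_nonsing_inv _ hdet, Matrix.one_mul, Matrix.mul_one]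

theorem continuous_liftFrame {X : Type*} [TopologicalSpace X] {a : X → Matrix ι ι ℂ}
    (ha : Continuous a) (hu : ∀ x, IsUnit (a x)) : Continuous fun x => liftFrame (a x) :=
  ha.matrix_conjTranspose.matrix_fromBlocks continuous_const continuous_const
    (continuous_matrix_inv ha hu)

/-- An invertible continuous matrix function on `[0, T]` is homotopic to the constant `1` through
such functions. -/
theorem exists_homotopy_isUnit {κ : Type*} [Fintype κ] [DecidableEq κ] {T : ℝ} (hT : 0 < T)
    {a : ℝ → Matrix κ κ ℂ} (ha : ContinuousOn a (Set.Icc 0 T))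
    (ha_inv : ∀ t ∈ Set.Icc 0 T, IsUnit (a t)) :
    ∃ A : ℝ × ℝ → Matrix κ κ ℂ, Continuous A ∧ (∀ x, IsUnit (A x)) ∧
      (∀ t, A (0, t) = 1) ∧ ∀ t ∈ Set.Icc 0 T, A (1, t) = a t := by
  have h0 : (0 : ℝ) ∈ Set.Icc 0 T := ⟨le_rfl, hT.le⟩
  obtain ⟨g, hg, hgu, hg0, hg1⟩ := exists_path_isUnit (ha_inv 0 h0)
  have hdet := (Matrix.isUnit_iff_isUnit_det _).1 (ha_inv 0 h0)
  let c : ℝ × ℝ → ℝ := fun x =>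
    (Set.projIcc (0 : ℝ) 1 zero_le_one x.1 : ℝ) * (Set.projIcc 0 T hT.le x.2 : ℝ)
  have hc : Continuous c :=
    (continuous_subtype_val.comp (continuous_projIcc.comp continuous_fst)).mul
      (continuous_subtype_val.comp (continuous_projIcc.comp continuous_snd))
  have hcm : ∀ x, c x ∈ Set.Icc 0 T := fun x =>
    ⟨mul_nonneg (Set.projIcc (0 : ℝ) 1 zero_le_one x.1).2.1 (Set.projIcc 0 T hT.le x.2).2.1,
      (mul_le_of_le_one_left (Set.projIcc 0 T hT.le x.2).2.1
        (Set.projIcc (0 : ℝ) 1 zero_le_one x.1).2.2).trans (Set.projIcc 0 T hT.le x.2).2.2⟩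
  -- With `c = s t`, the first factor contracts `a` to its value at `0`, and `g` joins `a(0)` to
  -- `1`. The projections onto `[0, 1]` and `[0, T]` extend the family to the whole plane.
  refine ⟨fun x => a (c x) * (a 0)⁻¹ * g x.1, ?_, fun x => ?_, fun t => ?_, fun t ht => ?_⟩
  · exact ((ha.comp_continuous hc hcm).matrix_mul continuous_const).matrix_mul
      (hg.comp continuous_fst)
  · exact ((ha_inv _ (hcm x)).mul (Matrix.isUnit_nonsing_inv_iff.2 (ha_inv 0 h0))).mul (hgu _)
  · have : c (0, t) = 0 := by simp [c]
    beta_reduce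
    rw [this, hg0, Matrix.mul_one, Matrix.mul_nonsing_inv _ hdet]
  · have : c (1, t) = t := by simp [c, Set.projIcc_of_mem hT.le ht]
    beta_reduce
    rw [this, hg1, Matrix.mul_assoc, Matrix.nonsing_inv_mul _ hdet, Matrix.mul_one]

theorem frameBoundary_one (R : Submodule ℂ (EuclideanSpace ℂ (ι ⊕ ι))) :
    frameBoundary 1 1 R = R := by
  ext w
  rw [eq_pair w, mem_frameBoundary_iff, Matrix.one_mulVec, Matrix.one_mulVec]

theorem finrank_graph_one_inf (R : Submodule ℂ (EuclideanSpace ℂ (ι ⊕ ι))) :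
    Module.finrank ℂ ↥(graph (1 : Matrix (ι ⊕ ι) (ι ⊕ ι) ℂ) ⊓ boundaryW R) +
      Module.finrank ℂ (graph (1 : Matrix ι ι ℂ)) + Module.finrank ℂ R =
      2 * Module.finrank ℂ ↥(graph (1 : Matrix ι ι ℂ) ⊓ R) + Fintype.card (ι ⊕ ι) := by
  rw [graph_one_eq_boundaryW, finrank_boundaryW_inf]

/-- The Maslov-type indices of a symplectic path and of its transform under a change of frame. -/
theorem maslovTypeIndex_liftFrame {T : ℝ} (hT : 0 < T) {a : ℝ → Matrix ι ι ℂ}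
    (ha : ContinuousOn a (Set.Icc 0 T)) (ha_inv : ∀ t ∈ Set.Icc 0 T, IsUnit (a t))
    {γ γ' : ℝ → Matrix (ι ⊕ ι) (ι ⊕ ι) ℂ} (hγ : ContinuousOn γ (Set.Icc 0 T)) (hγ0 : γ 0 = 1)
    (hsymp : ∀ t ∈ Set.Icc 0 T, (γ t)ᴴ * Matrix.J ι ℂ * γ t = Matrix.J ι ℂ)
    (hγ' : ∀ t ∈ Set.Icc 0 T, γ' t = liftFrame (a t) * γ t * (liftFrame (a 0))⁻¹)
    (R : Submodule ℂ (EuclideanSpace ℂ (ι ⊕ ι))) :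
    (∃! m : ℤ, IsMaslovTypeIndex T (boundaryW R) γ m) ∧
    (∃! m' : ℤ, IsMaslovTypeIndex T (boundaryW (frameBoundary (a 0) (a T) R)) γ' m') ∧
    ∀ m m' : ℤ, IsMaslovTypeIndex T (boundaryW R) γ m →
      IsMaslovTypeIndex T (boundaryW (frameBoundary (a 0) (a T) R)) γ' m' →
      m' - m =
        (Module.finrank ℂ ↥(graph (1 : Matrix ι ι ℂ) ⊓ frameBoundary (a 0) (a T) R) : ℤ) -
        (Module.finrank ℂ ↥(graph (1 : Matrix ι ι ℂ) ⊓ R) : ℤ) := by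
  have h0 : (0 : ℝ) ∈ Set.Icc 0 T := ⟨le_rfl, hT.le⟩
  have h1 : T ∈ Set.Icc 0 T := ⟨hT.le, le_rfl⟩
  obtain ⟨A, hA, hAu, hA0, hA1⟩ := exists_homotopy_isUnit hT ha ha_inv
  have hLu : ∀ x, IsUnit (liftFrame (A x)) := fun x => isUnit_liftFrame (hAu x)
  have hL : Continuous fun x => liftFrame (A x) := continuous_liftFrame hA hAu
  have hrow : ∀ t : ℝ, Continuous fun s : ℝ => (s, t) := fun t => by fun_prop
  let cl : ℝ → ℝ := fun t => Set.projIcc 0 T hT.le t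
  have hcl : ∀ t, cl t ∈ Set.Icc 0 T := fun t => (Set.projIcc 0 T hT.le t).2
  have hcl_eq : ∀ t ∈ Set.Icc 0 T, cl t = t := fun t ht =>
    congrArg Subtype.val (Set.projIcc_of_mem hT.le ht)
  have hγc : Continuous fun t => γ (cl t) :=
    hγ.comp_continuous (continuous_subtype_val.comp continuous_projIcc) hcl
  -- The right factor keeps `G (s, 0) = 1` throughout, so that the side `t = 0` consists of
  -- flip-invariant pairs.
  let G : ℝ × ℝ → Matrix (ι ⊕ ι) (ι ⊕ ι) ℂ := fun x =>
    liftFrame (A x) * γ (cl x.2) * (liftFrame (A (x.1, 0)))⁻¹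
  have hG : Continuous G := (hL.matrix_mul (hγc.comp continuous_snd)).matrix_mul
    (continuous_matrix_inv (hL.comp ((hrow 0).comp continuous_fst)) fun x => hLu _)
  have hGs : ∀ x, (G x)ᴴ * Matrix.J ι ℂ * G x = Matrix.J ι ℂ := fun x =>
    symplectic_mul (symplectic_mul (liftFrame_symplectic (hAu x)) (hsymp _ (hcl _)))
      (symplectic_inv (hLu _) (liftFrame_symplectic (hAu _)))
  have hGleft : ∀ s, G (s, 0) = 1 := fun s => by
    change liftFrame (A (s, 0)) * γ (cl 0) * (liftFrame (A (s, 0)))⁻¹ = 1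
    rw [hcl_eq 0 h0, hγ0, Matrix.mul_one,
      Matrix.mul_nonsing_inv _ ((Matrix.isUnit_iff_isUnit_det _).1 (hLu _))]
  have hG0 : ∀ t ∈ Set.Icc 0 T, G (0, t) = γ t := fun t ht => by
    change liftFrame (A (0, t)) * γ (cl t) * (liftFrame (A (0, 0)))⁻¹ = γ t
    rw [hcl_eq t ht, hA0, hA0, liftFrame_one, inv_one, Matrix.one_mul, Matrix.mul_one]
  have hG1 : ∀ t ∈ Set.Icc 0 T, G (1, t) = γ' t := fun t ht => by
    change liftFrame (A (1, t)) * γ (cl t) * (liftFrame (A (1, 0)))⁻¹ = γ' t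
    rw [hcl_eq t ht, hA1 t ht, hA1 0 h0, hγ' t ht]
  let Rs : ℝ → Submodule ℂ (EuclideanSpace ℂ (ι ⊕ ι)) := fun s =>
    frameBoundary (A (s, 0)) (A (s, T)) R
  have hRs0 : Rs 0 = R := by
    change frameBoundary (A (0, 0)) (A (0, T)) R = R
    rw [hA0, hA0, frameBoundary_one]
  have hRs1 : Rs 1 = frameBoundary (a 0) (a T) R := by
    change frameBoundary (A (1, 0)) (A (1, T)) R = _
    rw [hA1 0 h0, hA1 T h1]
  -- At `t = T` this carries both the graph and the boundary space from the original pair to the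
  -- pair at `s`.
  let Θ : ℝ → Matrix ((ι ⊕ ι) ⊕ (ι ⊕ ι)) ((ι ⊕ ι) ⊕ (ι ⊕ ι)) ℂ := fun s =>
    Matrix.fromBlocks (liftFrame (A (s, 0))) 0 0 (liftFrame (A (s, T)))
  have hΘ : Continuous Θ := (hL.comp (hrow 0)).matrix_fromBlocks continuous_const continuous_const
    (hL.comp (hrow T))
  have hΘu : ∀ s, IsUnit (Θ s) := fun s => isUnit_fromBlocks_diagonal (hLu _) (hLu _)
  have hΘW : ∀ s (w : EuclideanSpace ℂ ((ι ⊕ ι) ⊕ (ι ⊕ ι))),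
      WithLp.toLp 2 (Θ s *ᵥ w.ofLp) ∈ boundaryW (Rs s) ↔ w ∈ boundaryW R := fun s w =>
    mulVec_mem_boundaryW_iff (hAu _) (hAu _) R w
  have hΘG : ∀ s (w : EuclideanSpace ℂ ((ι ⊕ ι) ⊕ (ι ⊕ ι))),
      WithLp.toLp 2 (Θ s *ᵥ w.ofLp) ∈ graph (G (s, T)) ↔ w ∈ graph (γ (cl T)) := fun s w =>
    mulVec_mem_graph_iff (hLu _) (hLu _) _ w
  have hend : ∀ s, Module.finrank ℂ ↥(graph (G (s, T)) ⊓ boundaryW (Rs s)) =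
      Module.finrank ℂ ↥(graph (γ (cl T)) ⊓ boundaryW R) := fun s =>
    finrank_inf_eq_of_transform (hΘu s) (hΘG s) (hΘW s)
  obtain ⟨Z₀, hZ₀⟩ := exists_isLagrangianFrame_boundaryW R
  have hmain := maslovIndex_homotopy hT (Λ := fun x => graph (G x))
    (Λ' := fun s => boundaryW (Rs s)) (Z := fun x => Matrix.fromRows 1 (G x))
    (Z' := fun s => Θ s * Z₀)
    (continuous_matrix fun i k => by
      rcases i with i | i
      · exact continuous_const
      · exact hG.matrix_elem i k)
    (hΘ.matrix_mul continuous_const) (fun x => isLagrangianFrame_graph (hGs x))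
    (fun s => hZ₀.transform (hΘu s) (hΘW s) fun w hw w' hw' => boundaryW_isotropic _ hw hw')
    (fun s => (hend s).trans (hend 0).symm)
    (fun s => by
      simp only [hGleft]
      rw [graph_one_eq_boundaryW]
      exact fun w hw => flip_mem_boundaryW _ hw)
    (fun s w hw => flip_mem_boundaryW _ hw)
    (Λ₀ := fun t => graph (γ t)) (Λ₁ := fun t => graph (γ' t))
    (fun t ht => by rw [hG0 t ht]) (fun t ht => by rw [hG1 t ht])
  simp only [hRs0, hRs1] at hmain
  refine ⟨hmain.1, hmain.2.1, fun m m' hm hm' => ?_⟩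
  have h2 := hmain.2.2 m m' hm hm'
  rw [hGleft, hGleft, hRs0, hRs1] at h2
  have h3 := finrank_graph_one_inf R
  have h4 := finrank_graph_one_inf (frameBoundary (a 0) (a T) R)
  rw [finrank_frameBoundary (ha_inv 0 h0) (ha_inv T h1)] at h4
  -- The terms `dim R`, `dim Gr(I)` and `2n` cancel in the difference of `h4` and `h3`, leaving
  -- twice the claim.
  omega

end Homotopy

end MorseIndex

/-! ### The index formula for a change of frame -/

open MorseIndex in
theorem theorem1p3 (n : ℕ) (T : ℝ) (hT : 0 < T)
    (p q r : ℝ → Matrix (Fin n) (Fin n) ℂ)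
    (hp : IsC1On T p) (hq : ContinuousOn q (Set.Icc 0 T)) (hr : ContinuousOn r (Set.Icc 0 T))
    (hp_self : ∀ t ∈ Set.Icc 0 T, (p t).IsHermitian)
    (hr_self : ∀ t ∈ Set.Icc 0 T, (r t).IsHermitian)
    (hp_inv : ∀ t ∈ Set.Icc 0 T, IsUnit (p t))
    (R : Submodule ℂ (EuclideanSpace ℂ (Fin n ⊕ Fin n)))
    (a : ℝ → Matrix (Fin n) (Fin n) ℂ)
    (ha : IsC1On T a) (ha_inv : ∀ t ∈ Set.Icc 0 T, IsUnit (a t))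
    (R' : Submodule ℂ (EuclideanSpace ℂ (Fin n ⊕ Fin n)))
    (hR' : R' = frameBoundary (a 0) (a T) R)
    (γ γ' : ℝ → Matrix (Fin n ⊕ Fin n) (Fin n ⊕ Fin n) ℂ)
    (hγ : IsFundamentalSolution T (fun t => hamiltonian (p t) (q t) (r t)) γ)
    (hγ' : IsFundamentalSolution T
      (fun t => hamiltonian (frameP (p t) (a t)) (frameQ (p t) (q t) (a t) (dotC T a t))
        (frameR (p t) (q t) (r t) (a t) (dotC T a t))) γ') :
    (∃! m : ℤ, IsMaslovTypeIndex T (boundaryW R) γ m) ∧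
    (∃! m' : ℤ, IsMaslovTypeIndex T (boundaryW R') γ' m') ∧
    ∀ m m' : ℤ, IsMaslovTypeIndex T (boundaryW R) γ m →
      IsMaslovTypeIndex T (boundaryW R') γ' m' →
      m' - m = (Module.finrank ℂ ↥(graph (1 : Matrix (Fin n) (Fin n) ℂ) ⊓ R') : ℤ) -
        (Module.finrank ℂ ↥(graph (1 : Matrix (Fin n) (Fin n) ℂ) ⊓ R) : ℤ) := by
  subst hR'
  have hd : ∀ t ∈ Set.Icc 0 T, HasEntryDeriv a (dotC T a t) (Set.Icc 0 T) t := fun t ht i k =>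
    ((ha i k).differentiableOn one_ne_zero t ht).hasDerivWithinAt
  have hac : ContinuousOn a (Set.Icc 0 T) :=
    continuousOn_pi.2 fun i => continuousOn_pi.2 fun k => (ha i k).continuousOn
  have hγc : ContinuousOn γ (Set.Icc 0 T) :=
    continuousOn_pi.2 fun i => continuousOn_pi.2 fun k t ht => (hγ.2 t ht i k).continuousWithinAt
  exact maslovTypeIndex_liftFrame hT hac ha_inv hγc hγ.1
    (fun t ht => hγ.symplectic
      (fun t ht => isHermitian_hamiltonian (hp_self t ht) (hr_self t ht)) ht)
    (fun t ht => hγ.eq_liftFrame hp_self hr_self hp_inv ha_inv hd hγ' ht) R
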